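/- **Setting.** Let $a<b$ and let $F$ be a set-valued function on $[a,b]$ whose graph has $M$ separable holes with $C^4$ boundaries. That is, there are functions $\ell,u\in C^4[a,b]$ with $\ell<u$ on $[a,b]$ and, for $i=1,\dots,M$, intervals $[c_i,d_i]\subset(a,b)$, $c_i<d_i$, and functions $g_i,h_i\in C^4[c_i,d_i]$ with $g_i<h_i$ on $(c_i,d_i)$, $g_i(c_i)=h_i(c_i)$, $g_i(d_i)=h_i(d_i)$, such that the holes $H_i=\{(x,y): c_i<x<d_i,\ g_i(x)<y<h_i(x)\}$ have pairwise disjoint closures, $\ell<g_i$ and $h_i<u$ on $[c_i,d_i]$, and $$F(x)=[\ell(x),u(x)]\setminus\{y:(x,y)\in H_1\cup\dots\cup H_M\},\qquad x\in[a,b].$$ Assume moreover that the two boundary curves of each hole meet transversally at its points of change of topology (PCTs) $(c_i,g_i(c_i))$ and $(d_i,g_i(d_i))$: $(h_i-g_i)'(c_i)>0$ and $(h_i-g_i)'(d_i)<0$ (one-sided derivatives). **The approximation.** Let $N\ge 1$, $\Delta=(b-a)/N$, $x_k=a+k\Delta$ for $0\le k\le N$. All splines below are cubic spline interpolants with knots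 at the data points and not-a-knot end conditions (the third derivative is continuous at the first and at the last interior knot). 1. $\tilde\ell,\tilde u$ are the splines interpolating $\ell,u$ at $x_0,\dots,x_N$. 2. For a hole $H_i$ let $x_n,\dots,x_m$ be the points $x_k$ in $(c_i,d_i)$. Let $\tilde g_L,\tilde h_L$ be the cubic polynomials interpolating $g_i,h_i$ at $x_n,\dots,x_{n+3}$. Let $\tilde c_i$ be the abscissa of an intersection point of $\tilde g_L$ and $\tilde h_L$ in $[x_n-\Delta,x_n]$ if there is one, and $\tilde c_i=x_n-\Delta$ otherwise. Similarly let $\tilde g_R,\tilde h_R$ be the cubics interpolating $g_i,h_i$ at $x_{m-3},\dots,x_m$, and let $\tilde d_i$ be the abscissa of an intersection point of them in $[x_m,x_m+\Delta]$ if there is one, and $\tilde d_i=x_m+\Delta$ otherwise. 3. $\tilde g_i$ on $[\tilde c_i,\tilde d_i]$ is the spline interpolating the data $(\tilde c_i,\tilde g_L(\tilde c_i))$, $(x_k,g_i(x_k))_{k=n}^m$, $(\tilde d_i,\tilde g_R(\tilde d_i))$, and $\tilde h_i$ is obtained in the same way from $\tilde h_L$, $h_i$, $\tilde h_R$. 4.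 Extend $g_i,h_i$ from $[c_i,d_i]$, and $\tilde g_i,\tilde h_i$ from $[\tilde c_i,\tilde d_i]$, to the left and to the right by their constant end values; denote the extensions by $g_{e,i},h_{e,i},\tilde g_{e,i},\tilde h_{e,i}$. Call $\varepsilon>0$ admissible if the extended holes over $[c_i-\varepsilon,d_i+\varepsilon]$ touch neither each other nor $\ell,u$: for all $x\in[a,b]$ and all $i$ with $x\in[c_i-\varepsilon,d_i+\varepsilon]$ one has $\ell(x)<g_{e,i}(x)$ and $h_{e,i}(x)<u(x)$, and the intervals $[g_{e,i}(x),h_{e,i}(x)]$ for these $i$ are pairwise disjoint. 5. For admissible $\varepsilon$ and $x\in[a,b]$ let $i_1,\dots,i_J$ be the indices $i$ with $x\in[c_i-\varepsilon,d_i+\varepsilon]$, ordered by increasing $\tilde g_{e,i}(x)$, and put $$\tilde F(x)=[\tilde\ell(x),\tilde g_{e,i_1}(x)]\cup\bigcup_{j=1}^{J-1}[\tilde h_{e,i_j}(x),\tilde g_{e,i_{j+1}}(x)]\cup[\tilde h_{e,i_J}(x),\tilde u(x)],$$ and $\tilde F(x)=[\tilde\ell(x),\tilde u(x)]$ if $J=0$.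 **Theorem.** Admissible $\varepsilon$ exist, and there is a constant $C>0$ (independent of $\varepsilon$, $N$ and $x$) such that for every admissible $\varepsilon$ there is $\Delta_0>0$ with the following property: whenever $\Delta=(b-a)/N<\Delta_0$, for every $x\in[a,b]$ the set $\tilde F(x)$ is non-empty and compact, and $$d_H\big(F(x),\tilde F(x)\big)\le C\Delta^4 ,$$ where $d_H$ is the Hausdorff distance. -/

import Mathlib

open Set

namespace SetValued

/-! ### Interpolation on a grid -/

/-- The cubic polynomial interpolating `f` at the four nodes `v 0, v 1, v 2, v 3`. -/
noncomputable def cubicInterp (v : ℕ → ℝ) (f : ℝ → ℝ) : Polynomial ℝ :=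
  Lagrange.interpolate (Finset.range 4) v (fun j => f (v j))

/-- `s` is a cubic spline on `[t 0, t K]` with knots `t 0 < ... < t K` that interpolates the values
`y k` at the knots and satisfies the not-a-knot end conditions: on `[t k, t (k+1)]` it is the cubic
`p k`, the derivatives up to order two match at every interior knot, and the third derivative is
also continuous at the first and at the last interior knot, `t 1` and `t (K-1)`. -/
def IsNotAKnotSpline (K : ℕ) (t y : ℕ → ℝ) (s : ℝ → ℝ) : Prop :=
  ∃ p : ℕ → Polynomial ℝ,
    (∀ k < K, (p k).natDegree ≤ 3) ∧
    (∀ k < K, ∀ x ∈ Icc (t k) (t (k + 1)), s x = (p k).eval x) ∧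
    (∀ k ≤ K, s (t k) = y k) ∧
    (∀ k, k + 1 < K → ∀ r ≤ 2,
      (Polynomial.derivative^[r] (p k)).eval (t (k + 1)) =
        (Polynomial.derivative^[r] (p (k + 1))).eval (t (k + 1))) ∧
    (∀ k, k + 1 < K → (k = 0 ∨ k + 2 = K) →
      (Polynomial.derivative^[3] (p k)).eval (t (k + 1)) =
        (Polynomial.derivative^[3] (p (k + 1))).eval (t (k + 1)))

open Classical in
/-- The not-a-knot cubic spline interpolant of the data `(t k, y k)`, `k = 0, ..., K`
(zero if there is none). Its values matter only on `[t 0, t K]`. -/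
noncomputable def notAKnotSpline (K : ℕ) (t y : ℕ → ℝ) : ℝ → ℝ :=
  if hs : ∃ s, IsNotAKnotSpline K t y s then hs.choose else 0

/-- The function `f` on `[c, d]`, extended to the left and to the right by its end values. -/
noncomputable def extendConst (c d : ℝ) (f : ℝ → ℝ) (x : ℝ) : ℝ :=
  if x < c then f c else if x ≤ d then f x else f d

/-! ### Holes and set-valued functions with holes -/

/-- The data of a hole: the interval `[c, d]`, the lower boundary `g` and the upper boundary `h`
(only the values on `[c, d]` matter). -/
structure Hole where
  c : ℝ
  d : ℝ
  g : ℝ → ℝ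
  h : ℝ → ℝ

/-- The hole as a subset of the plane. -/
def Hole.region (H : Hole) : Set (ℝ × ℝ) :=
  {p | p.1 ∈ Ioo H.c H.d ∧ H.g p.1 < p.2 ∧ p.2 < H.h p.1}

/-- The hole is simple with `C^4` boundary functions, and sits over `[c, d] ⊆ (a, b)`. -/
structure Hole.IsC4 (H : Hole) (a b : ℝ) : Prop where
  a_lt : a < H.c
  c_lt_d : H.c < H.d
  lt_b : H.d < b
  g_smooth : ContDiffOn ℝ 4 H.g (Icc H.c H.d)
  h_smooth : ContDiffOn ℝ 4 H.h (Icc H.c H.d)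
  left_eq : H.g H.c = H.h H.c
  right_eq : H.g H.d = H.h H.d
  g_lt_h : ∀ x ∈ Ioo H.c H.d, H.g x < H.h x

/-- The two boundary curves of the hole meet transversally at the two points of change of
topology. -/
def Hole.IsTransversal (H : Hole) : Prop :=
  0 < derivWithin (fun x => H.h x - H.g x) (Icc H.c H.d) H.c ∧
    derivWithin (fun x => H.h x - H.g x) (Icc H.c H.d) H.d < 0

/-- The graph of `F` over `[a, b]` is the region between the lower boundary `l` and the upper
boundary `u`, from which the holes `H i` are removed; the holes have disjoint closures and do not
touch `l` and `u`, and all boundary functions are of class `C^4`. -/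
structure HasC4Holes (a b : ℝ) (F : ℝ → Set ℝ) (l u : ℝ → ℝ) {M : ℕ} (H : Fin M → Hole) :
    Prop where
  l_smooth : ContDiffOn ℝ 4 l (Icc a b)
  u_smooth : ContDiffOn ℝ 4 u (Icc a b)
  l_lt_u : ∀ x ∈ Icc a b, l x < u x
  hole : ∀ i, (H i).IsC4 a b
  separated : Pairwise fun i j => Disjoint (closure (H i).region) (closure (H j).region)
  inside : ∀ i, ∀ x ∈ Icc (H i).c (H i).d, l x < (H i).g x ∧ (H i).h x < u x
  value : ∀ x ∈ Icc a b, F x = Icc (l x) (u x) \ {y | ∃ i, (x, y) ∈ (H i).region}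

/-- `ε` is admissible for extending the boundary functions `g i`, `h i` by constants to
`[c i - ε, d i + ε]`: the extended holes touch neither each other nor `l` and `u`. -/
def IsAdmissible (a b : ℝ) (l u : ℝ → ℝ) {M : ℕ} (H : Fin M → Hole) (ε : ℝ) : Prop :=
  0 < ε ∧ ∀ i, ∀ x ∈ Icc a b, x ∈ Icc ((H i).c - ε) ((H i).d + ε) →
    l x < extendConst (H i).c (H i).d (H i).g x ∧
    extendConst (H i).c (H i).d (H i).h x < u x ∧
    ∀ j, j ≠ i → x ∈ Icc ((H j).c - ε) ((H j).d + ε) →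
      Disjoint
        (Icc (extendConst (H i).c (H i).d (H i).g x) (extendConst (H i).c (H i).d (H i).h x))
        (Icc (extendConst (H j).c (H j).d (H j).g x) (extendConst (H j).c (H j).d (H j).h x))

/-! ### The approximation -/

/-- The mesh size of the uniform partition of `[a, b]` into `N` intervals. -/
noncomputable def mesh (a b : ℝ) (N : ℕ) : ℝ := (b - a) / N

/-- The points of the uniform partition. -/
noncomputable def node (a b : ℝ) (N k : ℕ) : ℝ := a + k * mesh a b N

namespace Hole

variable (H : Hole) (a b : ℝ) (N : ℕ)

/-- The first index `n` of a partition point in `(c, d)`. -/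
noncomputable def firstIdx : ℕ := sInf {k | k ≤ N ∧ node a b N k ∈ Ioo H.c H.d}

/-- The last index `m` of a partition point in `(c, d)`. -/
noncomputable def lastIdx : ℕ := sSup {k | k ≤ N ∧ node a b N k ∈ Ioo H.c H.d}

/-- The cubic interpolating `f` at `x_n, x_{n+1}, x_{n+2}, x_{n+3}`. -/
noncomputable def leftCubic (f : ℝ → ℝ) : Polynomial ℝ :=
  cubicInterp (fun j => node a b N (H.firstIdx a b N + j)) f

/-- The cubic interpolating `f` at `x_m, x_{m-1}, x_{m-2}, x_{m-3}`. -/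
noncomputable def rightCubic (f : ℝ → ℝ) : Polynomial ℝ :=
  cubicInterp (fun j => node a b N (H.lastIdx a b N - j)) f

/-- `z` is the abscissa of an intersection point of the two left cubics in `[x_n - Δ, x_n]`. -/
def IsLeftCrossing (z : ℝ) : Prop :=
  z ∈ Icc (node a b N (H.firstIdx a b N) - mesh a b N) (node a b N (H.firstIdx a b N)) ∧
    (H.leftCubic a b N H.g).eval z = (H.leftCubic a b N H.h).eval z

/-- `z` is the abscissa of an intersection point of the two right cubics in `[x_m, x_m + Δ]`. -/
def IsRightCrossing (z : ℝ) : Prop :=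
  z ∈ Icc (node a b N (H.lastIdx a b N)) (node a b N (H.lastIdx a b N) + mesh a b N) ∧
    (H.rightCubic a b N H.g).eval z = (H.rightCubic a b N H.h).eval z

open Classical in
/-- The approximation of `c`: an intersection point of the left cubics in `[x_n - Δ, x_n]`, and
`x_n - Δ` if there is none. -/
noncomputable def cTilde : ℝ :=
  if hz : ∃ z, H.IsLeftCrossing a b N z then hz.choose
  else node a b N (H.firstIdx a b N) - mesh a b N

open Classical in
/-- The approximation of `d`: an intersection point of the right cubics in `[x_m, x_m + Δ]`, and
`x_m + Δ` if there is none. -/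
noncomputable def dTilde : ℝ :=
  if hz : ∃ z, H.IsRightCrossing a b N z then hz.choose
  else node a b N (H.lastIdx a b N) + mesh a b N

/-- The index of the last knot in the list `c̃, x_n, ..., x_m, d̃`. -/
noncomputable def lastKnot : ℕ := H.lastIdx a b N - H.firstIdx a b N + 2

/-- The knots `c̃, x_n, ..., x_m, d̃`. -/
noncomputable def knot (k : ℕ) : ℝ :=
  if k = 0 then H.cTilde a b N
  else if k < H.lastKnot a b N then node a b N (H.firstIdx a b N + (k - 1))
  else H.dTilde a b N

/-- The data attached to the knots for the boundary function `f` (which is `g` or `h`): the values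
of the left and of the right cubic at `c̃` and at `d̃`, and the samples of `f` in between. -/
noncomputable def knotValue (f : ℝ → ℝ) (k : ℕ) : ℝ :=
  if k = 0 then (H.leftCubic a b N f).eval (H.cTilde a b N)
  else if k < H.lastKnot a b N then f (node a b N (H.firstIdx a b N + (k - 1)))
  else (H.rightCubic a b N f).eval (H.dTilde a b N)

/-- The approximation of the boundary function `f` (which is `g` or `h`): the not-a-knot spline on
`[c̃, d̃]`, extended by constants. -/
noncomputable def approxBoundary (f : ℝ → ℝ) : ℝ → ℝ :=
  extendConst (H.cTilde a b N) (H.dTilde a b N)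
    (notAKnotSpline (H.lastKnot a b N) (H.knot a b N) (H.knotValue a b N f))

end Hole

/-- `[bot, g i₁] ∪ [h i₁, g i₂] ∪ ... ∪ [h i_J, top]` for the list `i₁, ..., i_J`, and
`[bot, top]` for the empty list. -/
def bands {ι : Type} (g h : ι → ℝ) (top : ℝ) : ℝ → List ι → Set ℝ
  | bot, [] => Icc bot top
  | bot, i :: L => Icc bot (g i) ∪ bands g h top (h i) L

/-- The not-a-knot spline interpolant of `f` at all points of the uniform partition. -/
noncomputable def gridSpline (a b : ℝ) (N : ℕ) (f : ℝ → ℝ) : ℝ → ℝ :=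
  notAKnotSpline N (node a b N) (fun k => f (node a b N k))

/-- The approximation of the set-valued function: at `x`, the holes with
`x ∈ [c i - ε, d i + ε]` are ordered by the values of the approximate lower boundaries, and the
value is the union of the intervals between consecutive approximate boundaries. -/
noncomputable def approx (a b : ℝ) (l u : ℝ → ℝ) {M : ℕ} (H : Fin M → Hole) (ε : ℝ) (N : ℕ)
    (x : ℝ) : Set ℝ :=
  bands (fun i => (H i).approxBoundary a b N (H i).g x)
    (fun i => (H i).approxBoundary a b N (H i).h x)
    (gridSpline a b N u x) (gridSpline a b N l x)
    (((List.finRange M).filter fun i => x ∈ Icc ((H i).c - ε) ((H i).d + ε)).insertionSort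
      fun i j => (H i).approxBoundary a b N (H i).g x ≤ (H j).approxBoundary a b N (H j).g x)

end SetValued

/-!
The boundary functions of a hole, extended by constants, are approximated *uniformly on the whole
line* with fourth order; the estimate of the Hausdorff distance follows from this, because both sets
are unions of bands between boundaries.

**Splines.** A not-a-knot spline is studied through its second derivatives `M k` at the knots. They
solve a tridiagonal system, and the not-a-knot conditions eliminate the first and the last of them.
If `p` and `q` are the lengths of the first two mesh intervals, the first row of the reduced system
is `(p + 2 q) M 1 + (q - p) M 2`, which is diagonally dominant whenever `p ≤ q`, however small `p`
is. Hence the system is stable (`moments_le`) and solvable (`exists_moments`). The Taylor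
coefficients of the interpolated function satisfy it up to second order, so the second derivative
of the spline is accurate to second order and the spline itself to fourth order
(`abs_spline_sub_le`). The data at the first knot may be perturbed by an amount proportional to `p`;
the extrapolation by the cubic interpolant has exactly such an error (`abs_sub_cubicInterp_le`).
So it does no harm that the approximate point of change of topology may be very close to the next
grid point.

**Points of change of topology.** The two interpolating cubics differ by an amount `q` that is
`O(Δ ^ 4)`-close to the difference `w` of the exact boundary functions, and `w` has a positive slope
at its zero `c`. So a zero of `q` is `O(Δ ^ 4)`-close to `c`; if `q` has no zero on the grid interval,
then the left end point of this interval is (`abs_crossing_sub_le`). A constant extension is a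
composition with a clamping map, and these maps depend on their end points in a Lipschitz way.
This gives `Hole.exists_abs_approxBoundary_sub_le`. The exact boundary functions are extended to
functions of class `C^4` on the line first, so that they can be evaluated beyond `c` and `d`.

**Bands.** By compactness, for an admissible `ε` different boundaries keep a distance `γ > 0`
(`HasC4Holes.exists_gap`). As soon as the errors are small compared with `γ`, the order of the
approximate boundaries is the exact one, and every band is moved by at most the error of its end
points (`HasC4Holes.approx_spec`). Over `[c - ε, c]` the exact hole degenerates to a single point,
which does not change the set.
-/

namespace SetValued

/-! ### Cubic polynomials and the moment equations -/

theorem cubic_taylor {p : Polynomial ℝ} (hp : p.natDegree ≤ 3) (s x : ℝ) :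
    p.eval x = p.eval s + (Polynomial.derivative^[1] p).eval s * (x - s)
      + (Polynomial.derivative^[2] p).eval s / 2 * (x - s) ^ 2
      + (Polynomial.derivative^[3] p).eval s / 6 * (x - s) ^ 3 ∧
    (Polynomial.derivative^[1] p).eval x = (Polynomial.derivative^[1] p).eval s
      + (Polynomial.derivative^[2] p).eval s * (x - s)
      + (Polynomial.derivative^[3] p).eval s / 2 * (x - s) ^ 2 ∧
    (Polynomial.derivative^[2] p).eval x = (Polynomial.derivative^[2] p).eval s
      + (Polynomial.derivative^[3] p).eval s * (x - s) ∧
    (Polynomial.derivative^[3] p).eval x = (Polynomial.derivative^[3] p).eval s := by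
  have h := p.as_sum_range_C_mul_X_pow' (n := 4) (by omega)
  generalize p.coeff = a at h
  subst h
  simp only [Finset.sum_range_succ, Finset.sum_range_zero, Function.iterate_succ,
    Function.iterate_zero, Function.comp, id, Polynomial.derivative_add,
    Polynomial.derivative_C_mul_X_pow, Polynomial.eval_add,
    Polynomial.eval_mul, Polynomial.eval_C, Polynomial.eval_pow, Polynomial.eval_X,
    Polynomial.derivative_zero, Polynomial.eval_zero]
  norm_num
  refine ⟨?_, ?_, ?_⟩ <;> ring

/-- The second derivatives `E k` of a cubic spline at the knots solve a tridiagonal system, whose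
first and last unknowns are eliminated with the not-a-knot conditions. After the elimination the
system is diagonally dominant, provided that the first and the last mesh interval are at most as
long as their neighbours, hence `E` is bounded by the residuals. -/
theorem moments_le {n : ℕ} {t E : ℕ → ℝ} {R : ℝ} (ht : ∀ k < n + 3, t k < t (k + 1))
    (hfirst : t 1 - t 0 ≤ t 2 - t 1) (hlast : t (n + 3) - t (n + 2) ≤ t (n + 2) - t (n + 1))
    (hrow : ∀ k < n + 2, |(t (k + 1) - t k) * E k + 2 * (t (k + 2) - t k) * E (k + 1)
      + (t (k + 2) - t (k + 1)) * E (k + 2)| ≤ R * (t (k + 2) - t k))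
    (hl : |(t 2 - t 1) * (E 1 - E 0) - (t 1 - t 0) * (E 2 - E 1)| ≤ R * (t 2 - t 1))
    (hr : |(t (n + 2) - t (n + 1)) * (E (n + 2) - E (n + 3)) -
      (t (n + 3) - t (n + 2)) * (E (n + 1) - E (n + 2))| ≤ R * (t (n + 2) - t (n + 1))) :
    ∀ k ≤ n + 3, |E k| ≤ 7 * R := by
  -- the elimination of an unknown at the end of the grid
  have elim : ∀ {p q e₀ e₁ e₂ : ℝ}, 0 < p → p ≤ q →
      |p * e₀ + 2 * (p + q) * e₁ + q * e₂| ≤ R * (p + q) →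
      |q * (e₁ - e₀) - p * (e₂ - e₁)| ≤ R * q →
      (|e₂| ≤ |e₁| → |e₁| ≤ 2 * R) ∧
      (|e₁| ≤ 2 * R → |e₂| ≤ 2 * R → |e₀| ≤ 7 * R) := by
    intro p q e₀ e₁ e₂ hp hpq h1 h2
    have hq : 0 < q := hp.trans_le hpq
    have hR : 0 ≤ R := by
      by_contra h
      have := (abs_nonneg _).trans h2
      nlinarith
    constructor
    · intro h21
      have key : (p + q) * ((p + 2 * q) * e₁ + (q - p) * e₂) =
          q * (p * e₀ + 2 * (p + q) * e₁ + q * e₂) +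
            p * (q * (e₁ - e₀) - p * (e₂ - e₁)) := by ring
      have h3 : (p + q) * |(p + 2 * q) * e₁ + (q - p) * e₂| ≤ (p + q) * (2 * R * q) := by
        rw [← abs_of_pos (add_pos hp hq), ← abs_mul, key, abs_of_pos (add_pos hp hq)]
        refine (abs_add_le _ _).trans ?_
        rw [abs_mul, abs_mul, abs_of_pos hp, abs_of_pos hq]
        have := mul_le_mul_of_nonneg_left h1 hq.le
        have := mul_le_mul_of_nonneg_left h2 hp.le
        nlinarith [mul_nonneg hR (mul_pos hq hq).le]
      have h4 := le_of_mul_le_mul_left h3 (add_pos hp hq)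
      have h5 : (p + 2 * q) * |e₁| ≤ |(p + 2 * q) * e₁ + (q - p) * e₂| + (q - p) * |e₂| := by
        have : (p + 2 * q) * |e₁| = |(p + 2 * q) * e₁| := by
          rw [abs_mul, abs_of_pos (by linarith : 0 < p + 2 * q)]
        have h6 : (q - p) * |e₂| = |(q - p) * e₂| := by
          rw [abs_mul, abs_of_nonneg (by linarith : 0 ≤ q - p)]
        rw [this, h6]
        have := abs_sub ((p + 2 * q) * e₁ + (q - p) * e₂) ((q - p) * e₂)
        rwa [add_sub_cancel_right] at this
      have h6 := mul_le_mul_of_nonneg_left h21 (sub_nonneg.2 hpq)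
      have h7 := mul_nonneg hp.le (abs_nonneg e₁)
      exact le_of_mul_le_mul_left (a := q) (by nlinarith) hq
    · intro h1' h2'
      have h3 : q * |e₀| ≤ q * (7 * R) := by
        have : q * e₀ = (q + p) * e₁ - p * e₂ - (q * (e₁ - e₀) - p * (e₂ - e₁)) := by ring
        rw [← abs_of_pos hq, ← abs_mul, this, abs_of_pos hq]
        have a1 := abs_sub ((q + p) * e₁ - p * e₂) (q * (e₁ - e₀) - p * (e₂ - e₁))
        have a2 := abs_sub ((q + p) * e₁) (p * e₂)
        rw [abs_mul, abs_mul, abs_of_pos hp, abs_of_pos (add_pos hq hp)] at a2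
        nlinarith [mul_le_mul_of_nonneg_left h1' (add_pos hq hp).le,
          mul_le_mul_of_nonneg_left h2' hp.le]
      exact le_of_mul_le_mul_left h3 hq
  have left := elim (p := t 1 - t 0) (q := t 2 - t 1) (e₀ := E 0) (e₁ := E 1) (e₂ := E 2)
    (sub_pos.2 (ht 0 (by omega))) hfirst (by convert hrow 0 (by omega) using 2 <;> ring_nf) hl
  have right := elim (p := t (n + 3) - t (n + 2)) (q := t (n + 2) - t (n + 1)) (e₀ := E (n + 3))
    (e₁ := E (n + 2)) (e₂ := E (n + 1)) (sub_pos.2 (ht (n + 2) (by omega))) hlast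
    (by convert hrow (n + 1) (by omega) using 2 <;> ring_nf) hr
  obtain ⟨k, hk, hmax⟩ := Finset.exists_max_image (Finset.range (n + 2)) (fun k => |E (k + 1)|)
    ⟨0, by simp⟩
  rw [Finset.mem_range] at hk
  replace hmax : ∀ j < n + 2, |E (j + 1)| ≤ |E (k + 1)| := fun j hj => hmax j (by simpa using hj)
  have hm : |E (k + 1)| ≤ 2 * R := by
    rcases Nat.eq_zero_or_pos k with rfl | hk0
    · exact left.1 (hmax 1 (by omega))
    rcases eq_or_ne k (n + 1) with rfl | hk1
    · exact right.1 (hmax n (by omega))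
    obtain ⟨j, rfl⟩ : ∃ j, k = j + 1 := ⟨k - 1, by omega⟩
    have h0 := hmax j (by omega)
    have h2 := hmax (j + 2) (by omega)
    have hrow := hrow (j + 1) hk
    have hp := sub_pos.2 (ht (j + 1) (by omega))
    have hq := sub_pos.2 (ht (j + 2) (by omega))
    set p := t (j + 1 + 1) - t (j + 1)
    set q := t (j + 2 + 1) - t (j + 2)
    have e1 : t (j + 1 + 2) - t (j + 1) = p + q := by simp only [p, q]; ring_nf
    rw [e1] at hrow
    have hR : 0 ≤ R := by
      have := (abs_nonneg _).trans hrow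
      by_contra h
      nlinarith
    have h3 : 2 * (p + q) * |E (j + 1 + 1)| ≤
        R * (p + q) + p * |E (j + 1)| + q * |E (j + 2 + 1)| := by
      have a1 := abs_sub (p * E (j + 1) + 2 * (p + q) * E (j + 1 + 1) + q * E (j + 1 + 2))
        (p * E (j + 1) + q * E (j + 1 + 2))
      have a2 := abs_add_le (p * E (j + 1)) (q * E (j + 1 + 2))
      rw [show p * E (j + 1) + 2 * (p + q) * E (j + 1 + 1) + q * E (j + 1 + 2) -
        (p * E (j + 1) + q * E (j + 1 + 2)) = 2 * (p + q) * E (j + 1 + 1) by ring, abs_mul,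
        abs_of_pos (by linarith : 0 < 2 * (p + q))] at a1
      rw [abs_mul, abs_mul, abs_of_pos hp, abs_of_pos hq] at a2
      change _ ≤ R * (p + q) + p * |E (j + 1)| + q * |E (j + 1 + 2)|
      linarith
    have h4 := mul_le_mul_of_nonneg_left h0 hp.le
    have h5 := mul_le_mul_of_nonneg_left h2 hq.le
    have : |E (j + 1 + 1)| ≤ R := le_of_mul_le_mul_left (a := p + q) (by nlinarith) (by linarith)
    linarith
  have hR : 0 ≤ R := by linarith [abs_nonneg (E (k + 1))]
  have hall : ∀ j < n + 2, |E (j + 1)| ≤ 2 * R := fun j hj => (hmax j hj).trans hm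
  intro j hj
  rcases Nat.eq_zero_or_pos j with rfl | hj0
  · exact left.2 (hall 0 (by omega)) (hall 1 (by omega))
  rcases eq_or_ne j (n + 3) with rfl | hj1
  · exact right.2 (hall (n + 1) (by omega)) (hall n (by omega))
  obtain ⟨i, rfl⟩ : ∃ i, j = i + 1 := ⟨j - 1, by omega⟩
  linarith [hall i (by omega)]

/-! ### Existence of the not-a-knot spline -/

theorem exists_cubic (s A D M T : ℝ) : ∃ p : Polynomial ℝ, p.natDegree ≤ 3 ∧ p.eval s = A ∧
    (Polynomial.derivative^[1] p).eval s = D ∧ (Polynomial.derivative^[2] p).eval s = M ∧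
    (Polynomial.derivative^[3] p).eval s = T := by
  refine ⟨Polynomial.C A + Polynomial.C D * (Polynomial.X - Polynomial.C s) +
    Polynomial.C (M / 2) * (Polynomial.X - Polynomial.C s) ^ 2 +
    Polynomial.C (T / 6) * (Polynomial.X - Polynomial.C s) ^ 3, by compute_degree, ?_, ?_, ?_, ?_⟩
  all_goals simp [Polynomial.derivative_pow]
  all_goals ring

/-- The moment equations of a not-a-knot spline are solvable: the stability estimate `moments_le`
makes the system injective, and the system is square. -/
theorem exists_moments {n : ℕ} {t : ℕ → ℝ} (ht : ∀ k < n + 3, t k < t (k + 1))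
    (hfirst : t 1 - t 0 ≤ t 2 - t 1) (hlast : t (n + 3) - t (n + 2) ≤ t (n + 2) - t (n + 1))
    (r : ℕ → ℝ) : ∃ E : ℕ → ℝ,
    (∀ k < n + 2, (t (k + 1) - t k) * E k + 2 * (t (k + 2) - t k) * E (k + 1)
      + (t (k + 2) - t (k + 1)) * E (k + 2) = r k) ∧
    (t 2 - t 1) * (E 1 - E 0) - (t 1 - t 0) * (E 2 - E 1) = 0 ∧
    (t (n + 2) - t (n + 1)) * (E (n + 2) - E (n + 3)) -
      (t (n + 3) - t (n + 2)) * (E (n + 1) - E (n + 2)) = 0 := by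
  let ext : (Fin (n + 4) → ℝ) → ℕ → ℝ := fun v k => if h : k < n + 4 then v ⟨k, h⟩ else 0
  have ext_add : ∀ v w k, ext (v + w) k = ext v k + ext w k := by
    intro v w k; simp only [ext]; split_ifs <;> simp
  have ext_smul : ∀ (c : ℝ) v k, ext (c • v) k = c * ext v k := by
    intro c v k; simp only [ext]; split_ifs <;> simp
  let T : (Fin (n + 4) → ℝ) →ₗ[ℝ] (Fin (n + 4) → ℝ) :=
    { toFun := fun v i =>
        if (i : ℕ) < n + 2 then (t (i + 1) - t i) * ext v i + 2 * (t (i + 2) - t i) * ext v (i + 1)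
          + (t (i + 2) - t (i + 1)) * ext v (i + 2)
        else if (i : ℕ) = n + 2 then
          (t 2 - t 1) * (ext v 1 - ext v 0) - (t 1 - t 0) * (ext v 2 - ext v 1)
        else (t (n + 2) - t (n + 1)) * (ext v (n + 2) - ext v (n + 3)) -
          (t (n + 3) - t (n + 2)) * (ext v (n + 1) - ext v (n + 2))
      map_add' := by
        intro v w; funext i
        simp only [ext_add, Pi.add_apply]
        split_ifs <;> ring
      map_smul' := by
        intro c v; funext i
        simp only [ext_smul, Pi.smul_apply, smul_eq_mul, RingHom.id_apply]
        split_ifs <;> ring }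
  have hT : ∀ v i, T v i =
        if (i : ℕ) < n + 2 then (t (i + 1) - t i) * ext v i + 2 * (t (i + 2) - t i) * ext v (i + 1)
          + (t (i + 2) - t (i + 1)) * ext v (i + 2)
        else if (i : ℕ) = n + 2 then
          (t 2 - t 1) * (ext v 1 - ext v 0) - (t 1 - t 0) * (ext v 2 - ext v 1)
        else (t (n + 2) - t (n + 1)) * (ext v (n + 2) - ext v (n + 3)) -
          (t (n + 3) - t (n + 2)) * (ext v (n + 1) - ext v (n + 2)) := fun v i => rfl
  have rows : ∀ v w, T v = w →
      (∀ k < n + 2, (t (k + 1) - t k) * ext v k + 2 * (t (k + 2) - t k) * ext v (k + 1)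
        + (t (k + 2) - t (k + 1)) * ext v (k + 2) = ext w k) ∧
      (t 2 - t 1) * (ext v 1 - ext v 0) - (t 1 - t 0) * (ext v 2 - ext v 1) = ext w (n + 2) ∧
      (t (n + 2) - t (n + 1)) * (ext v (n + 2) - ext v (n + 3)) -
        (t (n + 3) - t (n + 2)) * (ext v (n + 1) - ext v (n + 2)) = ext w (n + 3) := by
    intro v w h
    refine ⟨fun k hk => ?_, ?_, ?_⟩
    · have hk' : k < n + 4 := by omega
      have := congrFun h ⟨k, hk'⟩
      rw [hT, if_pos (by exact hk)] at this
      rw [this]; simp [ext, hk']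
    · have := congrFun h ⟨n + 2, by omega⟩
      rw [hT, if_neg (by simp), if_pos rfl] at this
      rw [this]; simp [ext]
    · have := congrFun h ⟨n + 3, by omega⟩
      rw [hT, if_neg (by simp), if_neg (by simp)] at this
      rw [this]; simp [ext]
  have hinj : Function.Injective T := by
    rw [← LinearMap.ker_eq_bot, LinearMap.ker_eq_bot']
    intro v hv
    obtain ⟨h1, h2, h3⟩ := rows v 0 hv
    have ext0 : ∀ k, ext 0 k = 0 := by intro k; simp [ext]
    have := moments_le (R := 0) (E := ext v) ht hfirst hlast
      (fun k hk => by rw [h1 k hk, ext0]; simp) (by rw [h2, ext0]; simp) (by rw [h3, ext0]; simp)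
    funext i
    have hi := this i (by omega)
    simpa [ext] using hi
  obtain ⟨v, hv⟩ := LinearMap.injective_iff_surjective.1 hinj
    (fun i => if (i : ℕ) < n + 2 then r i else 0)
  obtain ⟨h1, h2, h3⟩ := rows v _ hv
  refine ⟨ext v, fun k hk => ?_, ?_, ?_⟩
  · rw [h1 k hk]
    have hk' : k < n + 4 := by omega
    simp [ext, hk, hk']
  · rw [h2]; simp [ext]
  · rw [h3]; simp [ext]

/-- The moments and the data determine the cubics; a moment equation says that the first derivatives
of two neighbouring cubics match. -/
theorem exists_isNotAKnotSpline {n : ℕ} {t : ℕ → ℝ} (ht : ∀ k < n + 3, t k < t (k + 1))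
    (hfirst : t 1 - t 0 ≤ t 2 - t 1) (hlast : t (n + 3) - t (n + 2) ≤ t (n + 2) - t (n + 1))
    (y : ℕ → ℝ) : ∃ s, IsNotAKnotSpline (n + 3) t y s := by
  obtain ⟨E, hE, hl, hr⟩ := exists_moments ht hfirst hlast (fun k =>
    6 * ((y (k + 2) - y (k + 1)) / (t (k + 2) - t (k + 1)) -
      (y (k + 1) - y k) / (t (k + 1) - t k)))
  choose p hdeg hp0 hp1 hp2 hp3 using fun k => exists_cubic (t k) (y k)
    ((y (k + 1) - y k) / (t (k + 1) - t k) - (t (k + 1) - t k) * (2 * E k + E (k + 1)) / 6) (E k)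
    ((E (k + 1) - E k) / (t (k + 1) - t k))
  have hne : ∀ k < n + 3, t (k + 1) - t k ≠ 0 := fun k hk => (sub_pos.2 (ht k hk)).ne'
  have hq0 : ∀ k < n + 3, (p k).eval (t (k + 1)) = y (k + 1) := by
    intro k hk
    rw [(cubic_taylor (hdeg k) (t k) _).1, hp0, hp1, hp2, hp3]
    have := hne k hk
    field_simp
    ring
  have hmono : ∀ i j, i ≤ j → j ≤ n + 3 → t i ≤ t j := by
    intro i j hij
    induction j, hij using Nat.le_induction with
    | base => intro; exact le_rfl
    | succ j hij ih => intro hj; exact (ih (by omega)).trans (ht j (by omega)).le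
  classical
  let s : ℝ → ℝ := fun x =>
    if h : ∃ k < n + 3, x ∈ Icc (t k) (t (k + 1)) then (p h.choose).eval x else 0
  -- two cubics agree wherever their intervals meet
  have agree : ∀ i j x, i < j → j < n + 3 → x ∈ Icc (t i) (t (i + 1)) →
      x ∈ Icc (t j) (t (j + 1)) → (p i).eval x = (p j).eval x := by
    intro i j x hij hj hi hxj
    have h1 : t (i + 1) ≤ t j := hmono _ _ hij hj.le
    have hx : x = t (i + 1) := le_antisymm hi.2 (h1.trans hxj.1)
    have hji : j = i + 1 := by
      by_contra hne
      have := hmono (i + 1 + 1) j (by omega) hj.le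
      have := ht (i + 1) (by omega)
      linarith [hxj.1]
    subst hji
    rw [hx, hq0 i (by omega), hp0]
  have hs : ∀ k < n + 3, ∀ x ∈ Icc (t k) (t (k + 1)), s x = (p k).eval x := by
    intro k hk x hx
    have h : ∃ k < n + 3, x ∈ Icc (t k) (t (k + 1)) := ⟨k, hk, hx⟩
    simp only [s, dif_pos h]
    obtain ⟨h1, h2⟩ := h.choose_spec
    rcases lt_trichotomy h.choose k with hlt | heq | hgt
    · exact agree _ _ x hlt hk h2 hx
    · rw [heq]
    · exact (agree _ _ x hgt h1 hx h2).symm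
  refine ⟨s, p, fun k _ => hdeg k, hs, ?_, ?_, ?_⟩
  · intro k hk
    rcases Nat.lt_or_ge k (n + 3) with h | h
    · rw [hs k h _ ⟨le_rfl, (ht k h).le⟩, hp0]
    · obtain rfl : k = n + 3 := by omega
      rw [hs (n + 2) (by omega) _ ⟨(ht _ (by omega)).le, le_rfl⟩, hq0 _ (by omega)]
  · intro k hk r hr
    have h1 := hne k (by omega)
    have h2 := hne (k + 1) hk
    interval_cases r
    · simp only [Function.iterate_zero, id]
      rw [hq0 k (by omega), hp0]
    · rw [(cubic_taylor (hdeg k) (t k) _).2.1, hp1, hp1, hp2, hp3]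
      have := hE k (by omega)
      simp only [show k + 1 + 1 = k + 2 from rfl] at *
      have e : t (k + 2) - t k = (t (k + 2) - t (k + 1)) + (t (k + 1) - t k) := by ring
      rw [e] at this
      generalize t (k + 2) - t (k + 1) = q at *
      generalize t (k + 1) - t k = p at *
      have h3 : (E (k + 1) - E k) / p / 2 * p ^ 2 = (E (k + 1) - E k) * p / 2 := by
        field_simp
      rw [h3]
      linarith
    · rw [(cubic_taylor (hdeg k) (t k) _).2.2.1, hp2, hp2, hp3]
      field_simp
      ring
  · intro k hk hk'
    have h1 := hne k (by omega)
    have h2 := hne (k + 1) hk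
    rw [(cubic_taylor (hdeg k) (t k) _).2.2.2, hp3, hp3, div_eq_div_iff h1 h2]
    rcases hk' with rfl | hk'
    · norm_num at *
      linarith
    · obtain rfl : k = n + 1 := by omega
      simp only [show n + 1 + 1 = n + 2 from rfl, show n + 1 + 1 + 1 = n + 3 from rfl] at *
      linarith

/-! ### Taylor bounds -/

/-- `f` is twice differentiable with derivatives `f₁`, `f₂`, and on `[a, b]` it is approximated by
its Taylor polynomials with coefficients `f₁`, `f₂`, `f₃` up to an error of fourth order, and `f₂`
by its own ones up to an error of second order. This is what the error estimates use of a function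
of class `C^4`. -/
structure TaylorBound (a b B : ℝ) (f f₁ f₂ f₃ : ℝ → ℝ) : Prop where
  deriv_one : ∀ x, HasDerivAt f (f₁ x) x
  deriv_two : ∀ x, HasDerivAt f₁ (f₂ x) x
  taylor : ∀ s ∈ Icc a b, ∀ x ∈ Icc a b,
    |f x - (f s + f₁ s * (x - s) + f₂ s / 2 * (x - s) ^ 2 + f₃ s / 6 * (x - s) ^ 3)| ≤
      B * |x - s| ^ 4
  taylor_two : ∀ s ∈ Icc a b, ∀ x ∈ Icc a b,
    |f₂ x - (f₂ s + f₃ s * (x - s))| ≤ B * |x - s| ^ 2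

theorem TaylorBound.mono {a b B B' : ℝ} {f f₁ f₂ f₃ : ℝ → ℝ} (h : TaylorBound a b B f f₁ f₂ f₃)
    (hB : B ≤ B') : TaylorBound a b B' f f₁ f₂ f₃ :=
  ⟨h.1, h.2, fun s hs x hx => (h.3 s hs x hx).trans (by gcongr),
    fun s hs x hx => (h.4 s hs x hx).trans (by gcongr)⟩

theorem abs_le_pow_succ_of_abs_deriv_le {a b B s : ℝ} {n : ℕ} {φ ψ : ℝ → ℝ} (hB : 0 ≤ B)
    (hs : s ∈ Icc a b) (hφ : ∀ x, HasDerivAt φ (ψ x) x) (h0 : φ s = 0)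
    (h : ∀ x ∈ Icc a b, |ψ x| ≤ B * |x - s| ^ n) :
    ∀ x ∈ Icc a b, |φ x| ≤ B * |x - s| ^ (n + 1) := by
  intro x hx
  have key := (convex_uIcc s x).norm_image_sub_le_of_norm_hasDerivWithin_le (f := φ) (f' := ψ)
    (C := B * |x - s| ^ n) (x := s) (y := x) (fun z _ => (hφ z).hasDerivWithinAt) (fun z hz => by
      refine (h z (uIcc_subset_Icc hs hx hz)).trans ?_
      gcongr B * ?_ ^ n
      exact abs_sub_left_of_mem_uIcc hz) left_mem_uIcc right_mem_uIcc
  rw [h0, sub_zero] at key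
  simpa [Real.norm_eq_abs, pow_succ, mul_assoc] using key

theorem exists_taylorBound {f : ℝ → ℝ} (hf : ContDiff ℝ 4 f) (a b : ℝ) :
    ∃ B f₁ f₂ f₃, 0 ≤ B ∧ TaylorBound a b B f f₁ f₂ f₃ := by
  have hd : ∀ k < 4, ∀ x, HasDerivAt (iteratedDeriv k f) (iteratedDeriv (k + 1) f x) x := by
    intro k hk x
    rw [iteratedDeriv_succ]
    exact ((hf.differentiable_iteratedDeriv k (by exact_mod_cast hk)) x).hasDerivAt
  obtain ⟨B, hB⟩ := (isCompact_Icc (a := a) (b := b)).exists_bound_of_continuousOn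
    (hf.continuous_iteratedDeriv 4 le_rfl).continuousOn
  have hd0 := hd 0 (by norm_num)
  have hd1 := hd 1 (by norm_num)
  have hd2 := hd 2 (by norm_num)
  have hd3 := hd 3 (by norm_num)
  simp only [iteratedDeriv_zero, zero_add] at hd0
  simp only [Nat.reduceAdd] at hd1 hd2 hd3
  generalize iteratedDeriv 1 f = f₁ at *
  generalize iteratedDeriv 2 f = f₂ at *
  generalize iteratedDeriv 3 f = f₃ at *
  generalize iteratedDeriv 4 f = f₄ at *
  rcases (Icc a b).eq_empty_or_nonempty with hab | ⟨x₀, hx₀⟩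
  · exact ⟨0, f₁, f₂, f₃, le_rfl, hd0, hd1, by simp [hab], by simp [hab]⟩
  have hB0 : 0 ≤ B := (norm_nonneg _).trans (hB x₀ hx₀)
  have pw : ∀ (s x : ℝ) (n : ℕ), HasDerivAt (fun x => (x - s) ^ (n + 1))
      ((n + 1 : ℕ) * (x - s) ^ n) x := by
    intro s x n
    simpa using ((hasDerivAt_id' x).sub_const s).fun_pow (n + 1)
  have t3 : ∀ s ∈ Icc a b, ∀ x ∈ Icc a b, |f₃ x - f₃ s| ≤ B * |x - s| ^ 1 := fun s hs =>
    abs_le_pow_succ_of_abs_deriv_le hB0 hs (fun x => (hd3 x).sub_const (f₃ s)) (by simp)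
      (fun x hx => by simpa using hB x hx)
  have t2 : ∀ s ∈ Icc a b, ∀ x ∈ Icc a b, |f₂ x - (f₂ s + f₃ s * (x - s))| ≤ B * |x - s| ^ 2 :=
    fun s hs => abs_le_pow_succ_of_abs_deriv_le hB0 hs (fun x => by
      refine ((hd2 x).sub ((hasDerivAt_const x (f₂ s)).add ((pw s x 0).const_mul (f₃ s)))).congr_deriv
        (g' := f₃ x - f₃ s) ?_ |>.congr_of_eventuallyEq (.of_forall fun z => ?_) <;> simp)
      (by simp) (t3 s hs)
  have t1 : ∀ s ∈ Icc a b, ∀ x ∈ Icc a b,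
      |f₁ x - (f₁ s + f₂ s * (x - s) + f₃ s / 2 * (x - s) ^ 2)| ≤ B * |x - s| ^ 3 :=
    fun s hs => abs_le_pow_succ_of_abs_deriv_le hB0 hs (fun x => by
      refine ((hd1 x).sub (((hasDerivAt_const x (f₁ s)).add ((pw s x 0).const_mul (f₂ s))).add
        ((pw s x 1).const_mul (f₃ s / 2)))).congr_deriv
        (g' := f₂ x - (f₂ s + f₃ s * (x - s))) ?_ |>.congr_of_eventuallyEq
          (.of_forall fun z => ?_) <;> simp; ring)
      (by simp) (t2 s hs)
  have t0 : ∀ s ∈ Icc a b, ∀ x ∈ Icc a b,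
      |f x - (f s + f₁ s * (x - s) + f₂ s / 2 * (x - s) ^ 2 + f₃ s / 6 * (x - s) ^ 3)| ≤
        B * |x - s| ^ 4 :=
    fun s hs => abs_le_pow_succ_of_abs_deriv_le hB0 hs (fun x => by
      refine ((hd0 x).sub ((((hasDerivAt_const x (f s)).add ((pw s x 0).const_mul (f₁ s))).add
        ((pw s x 1).const_mul (f₂ s / 2))).add ((pw s x 2).const_mul (f₃ s / 6)))).congr_deriv
        (g' := f₁ x - (f₁ s + f₂ s * (x - s) + f₃ s / 2 * (x - s) ^ 2)) ?_ |>.congr_of_eventuallyEq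
          (.of_forall fun z => ?_) <;> simp; ring)
      (by simp) (t1 s hs)
  exact ⟨B, f₁, f₂, f₃, hB0, hd0, hd1, t0, t2⟩

/-! ### The error of the not-a-knot spline -/

/-- The residual of a moment equation of an interpolating spline when the moments are replaced by
their errors `M - f''`. Here `h₀`, `h₁` are the lengths of two neighbouring mesh intervals, `r₀`,
`r₁` and `q₀`, `q₁` the remainders of the Taylor expansions of `f` and of `f''` about the middle
knot, and `e₀`, `e₁` the errors of the data. -/
theorem abs_row_le {h₀ h₁ D A B r₀ r₁ q₀ q₁ e₀ e₁ X : ℝ} (hp : 0 < h₀) (hq : 0 < h₁)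
    (hpD : h₀ ≤ D) (hqD : h₁ ≤ D) (hB : 0 ≤ B)
    (hr₀ : |r₀| ≤ B * h₀ ^ 4) (hr₁ : |r₁| ≤ B * h₁ ^ 4)
    (hq₀ : |q₀| ≤ B * h₀ ^ 2) (hq₁ : |q₁| ≤ B * h₁ ^ 2)
    (he₀ : |e₀| ≤ A * (h₀ * h₁ * D ^ 2)) (he₁ : |e₁| ≤ A * (h₀ * h₁ * D ^ 2))
    (hX : h₀ * h₁ * X = 6 * (h₀ * (r₁ + e₁) + h₁ * (r₀ + e₀)) -
      h₀ * h₁ * (h₀ * q₀ + h₁ * q₁)) :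
    |X| ≤ (7 * B + 6 * A) * D ^ 2 * (h₀ + h₁) := by
  have hh : 0 < h₀ * h₁ := mul_pos hp hq
  refine le_of_mul_le_mul_left ?_ hh
  have s0 : h₀ ^ 2 ≤ D ^ 2 := pow_le_pow_left₀ hp.le hpD 2
  have s1 : h₁ ^ 2 ≤ D ^ 2 := pow_le_pow_left₀ hq.le hqD 2
  have b0 : |r₀| ≤ B * D ^ 2 * h₀ ^ 2 := by
    refine hr₀.trans ?_
    have := mul_le_mul_of_nonneg_left s0 (mul_nonneg hB (sq_nonneg h₀))
    nlinarith
  have b1 : |r₁| ≤ B * D ^ 2 * h₁ ^ 2 := by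
    refine hr₁.trans ?_
    have := mul_le_mul_of_nonneg_left s1 (mul_nonneg hB (sq_nonneg h₁))
    nlinarith
  have c0 : |q₀| ≤ B * D ^ 2 := hq₀.trans (mul_le_mul_of_nonneg_left s0 hB)
  have c1 : |q₁| ≤ B * D ^ 2 := hq₁.trans (mul_le_mul_of_nonneg_left s1 hB)
  rw [show h₀ * h₁ * |X| = |h₀ * h₁ * X| by rw [abs_mul, abs_of_pos hh], hX]
  rw [abs_le] at *
  constructor <;>
  nlinarith [mul_le_mul_of_nonneg_left b0.1 hq.le, mul_le_mul_of_nonneg_left b0.2 hq.le,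
    mul_le_mul_of_nonneg_left b1.1 hp.le, mul_le_mul_of_nonneg_left b1.2 hp.le,
    mul_le_mul_of_nonneg_left he₀.1 hq.le, mul_le_mul_of_nonneg_left he₀.2 hq.le,
    mul_le_mul_of_nonneg_left he₁.1 hp.le, mul_le_mul_of_nonneg_left he₁.2 hp.le,
    mul_le_mul_of_nonneg_left c0.1 (mul_pos hh hp).le,
    mul_le_mul_of_nonneg_left c0.2 (mul_pos hh hp).le,
    mul_le_mul_of_nonneg_left c1.1 (mul_pos hh hq).le,
    mul_le_mul_of_nonneg_left c1.2 (mul_pos hh hq).le]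

/-- The residual of a not-a-knot condition when the moments are replaced by their errors. -/
theorem abs_notAKnot_le {p q D A B u v w x y z c : ℝ} (hp : 0 < p) (hpq : p ≤ q)
    (hqD : q ≤ D) (hA : 0 ≤ A) (hB : 0 ≤ B) (hx : |x - (y - c * p)| ≤ B * p ^ 2)
    (hz : |z - (y + c * q)| ≤ B * q ^ 2) (h : q * (v - u) = p * (w - v)) :
    |q * ((v - y) - (u - x)) - p * ((w - z) - (v - y))| ≤ (7 * B + 6 * A) * D ^ 2 * q := by
  have e : q * ((v - y) - (u - x)) - p * ((w - z) - (v - y)) =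
      q * (x - (y - c * p)) + p * (z - (y + c * q)) := by linear_combination h
  have hq := hp.trans_le hpq
  have hp2 : B * p ^ 2 ≤ B * D ^ 2 :=
    mul_le_mul_of_nonneg_left (pow_le_pow_left₀ hp.le (hpq.trans hqD) 2) hB
  have hq2 : B * q ^ 2 ≤ B * D ^ 2 :=
    mul_le_mul_of_nonneg_left (pow_le_pow_left₀ hq.le hqD 2) hB
  rw [e]
  refine (abs_add_le _ _).trans ?_
  rw [abs_mul, abs_mul, abs_of_pos hp, abs_of_pos hq]
  have h1 := mul_le_mul_of_nonneg_left (hx.trans hp2) hq.le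
  have h2 := mul_le_mul_of_nonneg_left (hz.trans hq2) hp.le
  have hBD : 0 ≤ B * D ^ 2 := by positivity
  have h3 := mul_le_mul_of_nonneg_right hpq hBD
  have h4 : 0 ≤ A * D ^ 2 * q := by positivity
  nlinarith [mul_nonneg hBD hq.le]

/-- A function with small second derivative on a short interval is small if it is small at the end
points. -/
theorem abs_le_of_abs_deriv_two_le {s e D A Q : ℝ} {φ φ₁ φ₂ : ℝ → ℝ} (hse : s < e)
    (hD : e - s ≤ D) (hφ : ∀ x, HasDerivAt φ (φ₁ x) x) (hφ₁ : ∀ x, HasDerivAt φ₁ (φ₂ x) x)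
    (hs : |φ s| ≤ A) (he : |φ e| ≤ A) (hQ : 0 ≤ Q) (h2 : ∀ x ∈ Icc s e, |φ₂ x| ≤ Q) :
    ∀ x ∈ Icc s e, |φ x| ≤ 3 * A + Q * D ^ 2 := by
  obtain ⟨ξ, hξ, hslope⟩ := exists_hasDerivAt_eq_slope φ φ₁ hse
    (fun x _ => (hφ x).continuousAt.continuousWithinAt) (fun x _ => hφ x)
  have hlen := sub_pos.2 hse
  have hξ' : φ₁ ξ * (e - s) = φ e - φ s := by rw [hslope]; field_simp
  intro x hx
  have d1 : ∀ z ∈ Icc s e, ‖φ₁ z‖ ≤ |φ₁ ξ| + Q * D := by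
    intro z hz
    have := (convex_Icc s e).norm_image_sub_le_of_norm_hasDerivWithin_le (f := φ₁) (f' := φ₂)
      (C := Q) (x := ξ) (y := z) (fun z _ => (hφ₁ z).hasDerivWithinAt) h2 (Ioo_subset_Icc_self hξ)
      hz
    have h3 : ‖z - ξ‖ ≤ D := by
      rw [Real.norm_eq_abs, abs_le]
      constructor <;> linarith [hz.1, hz.2, hξ.1, hξ.2]
    have h4 := mul_le_mul_of_nonneg_left h3 hQ
    have h5 := norm_le_insert' (φ₁ z) (φ₁ ξ)
    rw [Real.norm_eq_abs (φ₁ ξ)] at h5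
    linarith
  have h0 := (convex_Icc s e).norm_image_sub_le_of_norm_hasDerivWithin_le (f := φ) (f' := φ₁)
    (x := s) (y := x) (fun z _ => (hφ z).hasDerivWithinAt) d1 ⟨le_rfl, hse.le⟩ hx
  have h1 : ‖x - s‖ ≤ e - s := by
    rw [Real.norm_eq_abs, abs_le]
    constructor <;> linarith [hx.1, hx.2]
  have hD0 : 0 ≤ D := hlen.le.trans hD
  have h3 : |φ₁ ξ| * (e - s) ≤ 2 * A := by
    have : |φ₁ ξ| * (e - s) = |φ₁ ξ * (e - s)| := by rw [abs_mul, abs_of_pos hlen]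
    rw [this, hξ']
    linarith [abs_sub (φ e) (φ s)]
  have h4 := mul_le_mul_of_nonneg_left h1 (add_nonneg (abs_nonneg (φ₁ ξ)) (mul_nonneg hQ hD0))
  have h5 := mul_le_mul_of_nonneg_left hD (mul_nonneg hQ hD0)
  have h6 := norm_le_insert' (φ x) (φ s)
  rw [Real.norm_eq_abs, Real.norm_eq_abs] at h6
  nlinarith

theorem abs_convex_comb_le {c u v x y S W : ℝ} (hc₀ : 0 ≤ c) (hc₁ : c ≤ 1) (hx : |x| ≤ S)
    (hy : |y| ≤ S) (hv : |v| ≤ W) (hu : |u| ≤ W) :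
    |(1 - c) * x + c * y + c * v - u| ≤ S + 2 * W := by
  have c' : 0 ≤ 1 - c := by linarith
  have h1 := abs_sub ((1 - c) * x + c * y + c * v) u
  have h2 := abs_add_le ((1 - c) * x + c * y) (c * v)
  have h3 := abs_add_le ((1 - c) * x) (c * y)
  rw [abs_mul, abs_of_nonneg hc₀] at h2
  rw [abs_mul, abs_mul, abs_of_nonneg hc₀, abs_of_nonneg c'] at h3
  have h4 := mul_le_mul_of_nonneg_left hx c'
  have h5 := mul_le_mul_of_nonneg_left hy hc₀
  have h6 := mul_le_mul_of_nonneg_left hv hc₀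
  have h7 := mul_le_mul_of_nonneg_right hc₁ ((abs_nonneg v).trans hv)
  linarith

/-- The fourth order error estimate for not-a-knot spline interpolation. The first and the last
mesh interval may be arbitrarily short; in return the errors of the data at the first and at the
last knot have to be proportional to the lengths of these intervals. -/
theorem abs_spline_sub_le {n : ℕ} {t y s f f₁ f₂ f₃ : _ → ℝ} {a b A B D : ℝ}
    (ht : ∀ k < n + 3, t k < t (k + 1))
    (hfirst : t 1 - t 0 ≤ t 2 - t 1) (hlast : t (n + 3) - t (n + 2) ≤ t (n + 2) - t (n + 1))
    (hD : ∀ k < n + 3, t (k + 1) - t k ≤ D) (hmem : ∀ k ≤ n + 3, t k ∈ Icc a b)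
    (hA : 0 ≤ A) (hB : 0 ≤ B) (hf : TaylorBound a b B f f₁ f₂ f₃)
    (hs : IsNotAKnotSpline (n + 3) t y s)
    (hy : ∀ k, 0 < k → k < n + 3 → y k = f (t k))
    (hy₀ : |y 0 - f (t 0)| ≤ A * ((t 1 - t 0) * (t 2 - t 1) * D ^ 2))
    (hyK : |y (n + 3) - f (t (n + 3))| ≤
      A * ((t (n + 2) - t (n + 1)) * (t (n + 3) - t (n + 2)) * D ^ 2)) :
    ∀ x ∈ Icc (t 0) (t (n + 3)), |s x - f x| ≤ 51 * (A + B) * D ^ 4 := by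
  obtain ⟨p, hdeg, hsp, hsy, hmatch, hnak⟩ := hs
  have hpos : ∀ k < n + 3, 0 < t (k + 1) - t k := fun k hk => sub_pos.2 (ht k hk)
  have hD0 : 0 ≤ D := (hpos 0 (by omega)).le.trans (hD 0 (by omega))
  have hval : ∀ k < n + 3, (p k).eval (t k) = y k := fun k hk => by
    rw [← hsp k hk _ ⟨le_rfl, (ht k hk).le⟩, hsy k hk.le]
  have hval' : ∀ k < n + 3, (p k).eval (t (k + 1)) = y (k + 1) := fun k hk => by
    rw [← hsp k hk _ ⟨(ht k hk).le, le_rfl⟩, hsy (k + 1) hk]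
  -- the moments
  let M : ℕ → ℝ := fun k => if k < n + 3 then (Polynomial.derivative^[2] (p k)).eval (t k)
    else (Polynomial.derivative^[2] (p (n + 2))).eval (t (n + 3))
  have hM : ∀ k < n + 3, (Polynomial.derivative^[2] (p k)).eval (t k) = M k := fun k hk => by
    simp [M, hk]
  have hM' : ∀ k < n + 3, (Polynomial.derivative^[2] (p k)).eval (t (k + 1)) = M (k + 1) := by
    intro k hk
    by_cases h : k + 1 < n + 3
    · rw [hmatch k h 2 le_rfl, hM _ h]
    · obtain rfl : k = n + 2 := by omega
      simp [M]
  have hT : ∀ k < n + 3, M (k + 1) - M k =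
      (Polynomial.derivative^[3] (p k)).eval (t k) * (t (k + 1) - t k) := by
    intro k hk
    rw [← hM' k hk, ← hM k hk, (cubic_taylor (hdeg k hk) (t k) (t (k + 1))).2.2.1]
    ring
  have hdata : ∀ k ≤ n + 3, |y k - f (t k)| ≤ A * D ^ 4 := by
    intro k hk
    have small : ∀ {p q : ℝ}, 0 < p → p ≤ D → 0 < q → q ≤ D →
        A * (p * q * D ^ 2) ≤ A * D ^ 4 := by
      intro p q hp hpD hq hqD
      have : p * q ≤ D * D := mul_le_mul hpD hqD hq.le hD0
      refine mul_le_mul_of_nonneg_left ?_ hA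
      calc p * q * D ^ 2 ≤ D * D * D ^ 2 := mul_le_mul_of_nonneg_right this (sq_nonneg D)
        _ = D ^ 4 := by ring
    rcases Nat.eq_zero_or_pos k with rfl | h0
    · exact hy₀.trans (small (hpos 0 (by omega)) (hD 0 (by omega)) (hpos 1 (by omega))
        (hD 1 (by omega)))
    · rcases Nat.lt_or_ge k (n + 3) with h1 | h1
      · rw [hy k h0 h1, sub_self, abs_zero]
        positivity
      · obtain rfl : k = n + 3 := by omega
        exact hyK.trans (small (hpos (n + 1) (by omega)) (hD (n + 1) (by omega))
          (hpos (n + 2) (by omega)) (hD (n + 2) (by omega)))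
  have hdata₀ : ∀ k < n + 2, |y k - f (t k)| ≤
      A * ((t (k + 1) - t k) * (t (k + 2) - t (k + 1)) * D ^ 2) := by
    intro k hk
    rcases Nat.eq_zero_or_pos k with rfl | h0
    · exact hy₀
    · rw [hy k h0 (by omega), sub_self, abs_zero]
      have := hpos k (by omega)
      have := hpos (k + 1) (by omega)
      positivity
  have hdata₁ : ∀ k < n + 2, |y (k + 2) - f (t (k + 2))| ≤
      A * ((t (k + 1) - t k) * (t (k + 2) - t (k + 1)) * D ^ 2) := by
    intro k hk
    rcases eq_or_ne k (n + 1) with rfl | h0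
    · exact hyK
    · rw [hy (k + 2) (by omega) (by omega), sub_self, abs_zero]
      have := hpos k (by omega)
      have := hpos (k + 1) (by omega)
      positivity
  -- the moment equations
  have hrow : ∀ k < n + 2, |(t (k + 1) - t k) * (M k - f₂ (t k)) +
      2 * (t (k + 2) - t k) * (M (k + 1) - f₂ (t (k + 1))) +
      (t (k + 2) - t (k + 1)) * (M (k + 2) - f₂ (t (k + 2)))| ≤
      (7 * B + 6 * A) * D ^ 2 * (t (k + 2) - t k) := by
    intro k hk
    have hp := hpos k (by omega)
    have hq := hpos (k + 1) (by omega)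
    have hpD := hD k (by omega)
    have hqD := hD (k + 1) (by omega)
    have m0 := hmem k (by omega)
    have m1 := hmem (k + 1) (by omega)
    have m2 := hmem (k + 2) (by omega)
    have r0 := hf.taylor _ m1 _ m0
    have r1 := hf.taylor _ m1 _ m2
    have q0 := hf.taylor_two _ m1 _ m0
    have q1 := hf.taylor_two _ m1 _ m2
    have a0 : |t k - t (k + 1)| = t (k + 1) - t k := by rw [abs_sub_comm, abs_of_pos hp]
    have a1 : |t (k + 2) - t (k + 1)| = t (k + 2) - t (k + 1) := abs_of_pos hq
    rw [a0] at r0 q0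
    rw [a1] at r1 q1
    have key := abs_row_le hp hq hpD hqD hB r0 r1 q0 q1 (hdata₀ k hk) (hdata₁ k hk)
      (X := (t (k + 1) - t k) * (M k - f₂ (t k)) +
        2 * (t (k + 2) - t k) * (M (k + 1) - f₂ (t (k + 1))) +
        (t (k + 2) - t (k + 1)) * (M (k + 2) - f₂ (t (k + 2)))) ?_
    · rwa [show t (k + 1) - t k + (t (k + 1 + 1) - t (k + 1)) = t (k + 2) - t k by ring_nf] at key
    have v0 := (cubic_taylor (hdeg k (by omega)) (t (k + 1)) (t k)).1
    have v2 := (cubic_taylor (hdeg (k + 1) (by omega)) (t (k + 1)) (t (k + 2))).1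
    have w0 := (cubic_taylor (hdeg k (by omega)) (t (k + 1)) (t k)).2.2.1
    have w2 := (cubic_taylor (hdeg (k + 1) (by omega)) (t (k + 1)) (t (k + 2))).2.2.1
    have e1 := hmatch k (by omega) 1 (by norm_num)
    rw [hval k (by omega), hval' k (by omega), hM' k (by omega), e1] at v0
    rw [hval' (k + 1) (by omega), hval (k + 1) (by omega), hM (k + 1) (by omega)] at v2
    rw [hM k (by omega), hM' k (by omega)] at w0
    rw [hM' (k + 1) (by omega), hM (k + 1) (by omega)] at w2
    rw [hy (k + 1) (by omega) (by omega)] at v0 v2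
    simp only [show k + 1 + 1 = k + 2 from rfl] at *
    rw [v0, v2, w0, w2]
    ring
  -- the not-a-knot conditions
  have hl : |(t 2 - t 1) * ((M 1 - f₂ (t 1)) - (M 0 - f₂ (t 0))) -
      (t 1 - t 0) * ((M 2 - f₂ (t 2)) - (M 1 - f₂ (t 1)))| ≤
      (7 * B + 6 * A) * D ^ 2 * (t 2 - t 1) := by
    have m1 := hmem 1 (by omega)
    have q0 := hf.taylor_two _ m1 _ (hmem 0 (by omega))
    have q2 := hf.taylor_two _ m1 _ (hmem 2 (by omega))
    have h0 := hpos 0 (by omega)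
    have h1 := hpos 1 (by omega)
    refine abs_notAKnot_le h0 hfirst (hD 1 (by omega)) hA hB (c := f₃ (t 1)) ?_ ?_ ?_
    · rw [abs_sub_comm (t 0), abs_of_pos h0] at q0
      convert q0 using 2
      ring
    · rwa [abs_of_pos h1] at q2
    · have T0 := hT 0 (by omega)
      have T1 := hT 1 (by omega)
      have N := hnak 0 (by omega) (Or.inl rfl)
      rw [(cubic_taylor (hdeg 0 (by omega)) (t 0) (t (0 + 1))).2.2.2] at N
      simp only [zero_add, one_add_one_eq_two] at T0 T1 N
      rw [T0, T1, N]
      ring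
  have hr : |(t (n + 2) - t (n + 1)) *
      ((M (n + 2) - f₂ (t (n + 2))) - (M (n + 3) - f₂ (t (n + 3)))) -
      (t (n + 3) - t (n + 2)) *
      ((M (n + 1) - f₂ (t (n + 1))) - (M (n + 2) - f₂ (t (n + 2))))| ≤
      (7 * B + 6 * A) * D ^ 2 * (t (n + 2) - t (n + 1)) := by
    have m1 := hmem (n + 2) (by omega)
    have q0 := hf.taylor_two _ m1 _ (hmem (n + 3) (by omega))
    have q2 := hf.taylor_two _ m1 _ (hmem (n + 1) (by omega))
    have h0 := hpos (n + 2) (by omega)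
    have h1 := hpos (n + 1) (by omega)
    refine abs_notAKnot_le h0 hlast (hD (n + 1) (by omega)) hA hB (c := - f₃ (t (n + 2))) ?_ ?_ ?_
    · rw [abs_of_pos h0] at q0
      convert q0 using 2
      ring
    · rw [abs_sub_comm (t (n + 1)), abs_of_pos h1] at q2
      convert q2 using 2
      ring
    · have T0 := hT (n + 2) (by omega)
      have T1 := hT (n + 1) (by omega)
      have N := hnak (n + 1) (by omega) (Or.inr rfl)
      rw [(cubic_taylor (hdeg (n + 1) (by omega)) (t (n + 1)) (t (n + 1 + 1))).2.2.2] at N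
      simp only [show n + 1 + 1 = n + 2 from rfl, show n + 2 + 1 = n + 3 from rfl] at T0 T1 N
      rw [N] at T1
      linear_combination (t (n + 3) - t (n + 2)) * T1 - (t (n + 2) - t (n + 1)) * T0
  have hE := moments_le (E := fun k => M k - f₂ (t k)) ht hfirst hlast hrow hl hr
  intro x hx
  obtain ⟨k, hk, hxk⟩ : ∃ k < n + 3, x ∈ Icc (t k) (t (k + 1)) := by
    have : ∀ m, 0 < m → x ≤ t m → ∃ k < m, x ∈ Icc (t k) (t (k + 1)) := by
      intro m
      induction m with
      | zero => intro h; omega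
      | succ m ih =>
        intro _ hxm
        rcases le_or_gt (t m) x with h | h
        · exact ⟨m, by omega, h, hxm⟩
        · rcases Nat.eq_zero_or_pos m with rfl | h0
          · exact absurd hx.1 (not_le.2 h)
          · obtain ⟨k, hk, hxk⟩ := ih h0 h.le
            exact ⟨k, by omega, hxk⟩
    exact this (n + 3) (by omega) hx.2
  rw [hsp k hk x hxk]
  have hp := hpos k hk
  -- the moments contribute `7 * (7 * B + 6 * A)`, the linear interpolation of `f₂` another `2 * B`
  have hB2 : 0 ≤ (51 * B + 42 * A) * D ^ 2 := by positivity
  have := abs_le_of_abs_deriv_two_le (φ := fun x => (p k).eval x - f x)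
    (φ₁ := fun x => (Polynomial.derivative^[1] (p k)).eval x - f₁ x)
    (φ₂ := fun x => (Polynomial.derivative^[2] (p k)).eval x - f₂ x) (ht k hk) (hD k hk)
    (fun x => ((p k).hasDerivAt x).sub (hf.deriv_one x))
    (fun x => by
      have := ((Polynomial.derivative^[1] (p k)).hasDerivAt x).sub (hf.deriv_two x)
      rwa [← Function.iterate_succ_apply' Polynomial.derivative] at this)
    (by simpa only [hval k hk] using hdata k hk.le)
    (by simpa only [hval' k hk] using hdata (k + 1) hk) hB2 (fun z hz => ?_) x hxk
  · refine this.trans ?_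
    have : 0 ≤ A * D ^ 4 := by positivity
    nlinarith
  have hz0 : z ∈ Icc a b := ⟨(hmem k hk.le).1.trans hz.1, hz.2.trans (hmem (k + 1) hk).2⟩
  have t1 := hf.taylor_two _ (hmem k hk.le) _ hz0
  have t2 := hf.taylor_two _ (hmem k hk.le) _ (hmem (k + 1) hk)
  have small : ∀ w ∈ Icc (t k) (t (k + 1)), B * |w - t k| ^ 2 ≤ B * D ^ 2 := by
    intro w hw
    refine mul_le_mul_of_nonneg_left (pow_le_pow_left₀ (abs_nonneg _) ?_ 2) hB
    rw [abs_of_nonneg (sub_nonneg.2 hw.1)]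
    linarith [hw.2, hD k hk]
  replace t1 := t1.trans (small z hz)
  replace t2 := t2.trans (small _ ⟨(ht k hk).le, le_rfl⟩)
  have e0 := hE k hk.le
  have e1 := hE (k + 1) hk
  have hp2 := (cubic_taylor (hdeg k hk) (t k) z).2.2.1
  rw [hM k hk] at hp2
  obtain ⟨c, hc0, hc1, hc⟩ : ∃ c : ℝ, 0 ≤ c ∧ c ≤ 1 ∧ z - t k = c * (t (k + 1) - t k) :=
    ⟨(z - t k) / (t (k + 1) - t k), div_nonneg (sub_nonneg.2 hz.1) hp.le,
      (div_le_one hp).2 (by linarith [hz.2]), by field_simp⟩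
  have hp3 : (Polynomial.derivative^[2] (p k)).eval z = M k + c * (M (k + 1) - M k) := by
    rw [hp2, hT k hk, hc]; ring
  simp only [hp3]
  have split : M k + c * (M (k + 1) - M k) - f₂ z = (1 - c) * (M k - f₂ (t k)) +
      c * (M (k + 1) - f₂ (t (k + 1))) +
      c * (f₂ (t (k + 1)) - (f₂ (t k) + f₃ (t k) * (t (k + 1) - t k))) -
      (f₂ z - (f₂ (t k) + f₃ (t k) * (z - t k))) := by
    rw [hc]; ring
  rw [split]
  generalize f₂ z - (f₂ (t k) + f₃ (t k) * (z - t k)) = u at *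
  generalize f₂ (t (k + 1)) - (f₂ (t k) + f₃ (t k) * (t (k + 1) - t k)) = v at *
  generalize M k - f₂ (t k) = v0 at *
  generalize M (k + 1) - f₂ (t (k + 1)) = v1 at *
  have hBD : 0 ≤ B * D ^ 2 := by positivity
  exact (abs_convex_comb_le hc0 hc1 e0 e1 t2 t1).trans (by linarith)

/-! ### Extension of smooth functions and interpolation by one cubic -/

/-- A function of class `C^n` on a compact interval extends to a function of class `C^n` on the
line: extend the last derivative by constants and integrate. -/
theorem exists_contDiff_eqOn {c d : ℝ} (hcd : c < d) (n : ℕ) {f : ℝ → ℝ}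
    (hf : ContDiffOn ℝ n f (Icc c d)) : ∃ F : ℝ → ℝ, ContDiff ℝ n F ∧ EqOn F f (Icc c d) := by
  induction n generalizing f with
  | zero =>
    have hc : ContinuousOn f (Icc c d) := hf.continuousOn
    refine ⟨IccExtend hcd.le ((Icc c d).domRestrict f), ?_, fun x hx => ?_⟩
    · exact contDiff_zero.2 hc.domRestrict.Icc_extend'
    · rw [IccExtend_of_mem _ _ hx]; rfl
  | succ n ih =>
    have hu := uniqueDiffOn_Icc hcd
    have h := (contDiffOn_succ_iff_derivWithin hu).1 (by simpa using hf)
    obtain ⟨G, hG, hGf⟩ := ih h.2.2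
    have hGc : Continuous G := hG.continuous
    have hF : ∀ x, HasDerivAt (fun x => f c + ∫ z in c..x, G z) (G x) x := fun x =>
      (intervalIntegral.integral_hasDerivAt_right (hGc.intervalIntegrable _ _)
        (hGc.stronglyMeasurableAtFilter _ _) hGc.continuousAt).const_add _
    refine ⟨fun x => f c + ∫ z in c..x, G z, ?_, ?_⟩
    · have : ContDiff ℝ ((n : WithTop ℕ∞) + 1) (fun x => f c + ∫ z in c..x, G z) := by
        rw [contDiff_succ_iff_deriv]
        refine ⟨fun x => (hF x).differentiableAt, by simp, ?_⟩
        rwa [show deriv (fun x => f c + ∫ z in c..x, G z) = G from funext fun x => (hF x).deriv]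
      exact_mod_cast this
    · refine eq_of_derivWithin_eq (fun x _ => (hF x).differentiableAt.differentiableWithinAt) h.1
        (fun x hx => ?_) (by simp)
      rw [(hF x).hasDerivWithinAt.derivWithin (hu x (Ico_subset_Icc_self hx)),
        hGf (Ico_subset_Icc_self hx)]

theorem natDegree_cubicInterp_le {v : ℕ → ℝ} (hv : InjOn v (Finset.range 4)) (f : ℝ → ℝ) :
    (cubicInterp v f).natDegree ≤ 3 := by
  have h := Lagrange.degree_interpolate_lt (s := Finset.range 4) (fun j => f (v j)) hv
  rw [Finset.card_range, Polynomial.degree_lt_iff_coeff_zero] at h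
  exact Polynomial.natDegree_le_iff_coeff_eq_zero.2 fun N hN => h N hN

theorem eval_cubicInterp {v : ℕ → ℝ} (hv : InjOn v (Finset.range 4)) (f : ℝ → ℝ) {j : ℕ}
    (hj : j < 4) : (cubicInterp v f).eval (v j) = f (v j) :=
  Lagrange.eval_interpolate_at_node _ hv (Finset.mem_range.2 hj)

/-- The error of extrapolation by the cubic interpolant at four equidistant nodes. It is
proportional to the distance from the first node; this compensates for the shortness of the first
mesh interval in `abs_spline_sub_le`. The step `δ` may be negative. -/
theorem abs_sub_cubicInterp_le {a b B x₀ δ θ : ℝ} {f f₁ f₂ f₃ : ℝ → ℝ} (hB : 0 ≤ B)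
    (hf : TaylorBound a b B f f₁ f₂ f₃) {v : ℕ → ℝ} {g : ℝ → ℝ} (hδ : δ ≠ 0)
    (hv : ∀ j < 4, v j = x₀ + j * δ) (hmem : ∀ j < 4, v j ∈ Icc a b)
    (hg : ∀ j < 4, g (v j) = f (v j)) (hθ₀ : 0 ≤ θ) (hθ₁ : θ ≤ 1) (hx : x₀ - θ * δ ∈ Icc a b) :
    |(cubicInterp v g).eval (x₀ - θ * δ) - f (x₀ - θ * δ)| ≤
      1135 * B * θ * |δ| ^ 4 := by
  have hinj : InjOn v (Finset.range 4) := by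
    intro i hi j hj hij
    simp only [Finset.coe_range, mem_Iio] at hi hj
    rw [hv i hi, hv j hj, add_right_inj] at hij
    exact_mod_cast mul_right_cancel₀ hδ hij
  have hx₀ : x₀ ∈ Icc a b := by simpa [hv 0] using hmem 0 (by norm_num)
  obtain ⟨T, hT, hT0, hT1, hT2, hT3⟩ := exists_cubic x₀ (f x₀) (f₁ x₀) (f₂ x₀) (f₃ x₀)
  have hTe : ∀ x, T.eval x = f x₀ + f₁ x₀ * (x - x₀) + f₂ x₀ / 2 * (x - x₀) ^ 2 +
      f₃ x₀ / 6 * (x - x₀) ^ 3 := fun x => by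
    rw [(cubic_taylor hT x₀ x).1, hT0, hT1, hT2, hT3]
  set P := cubicInterp v g
  have hP : P.natDegree ≤ 3 := natDegree_cubicInterp_le hinj g
  have hPv : ∀ j < 4, P.eval (v j) = f (v j) := fun j hj => by
    rw [eval_cubicInterp hinj g hj, hg j hj]
  have hQ : (P - T).natDegree ≤ 3 := (Polynomial.natDegree_sub_le _ _).trans (max_le hP hT)
  set S := 81 * B * |δ| ^ 4
  have hQv : ∀ j : ℕ, j < 4 → |(P - T).eval (x₀ + j * δ)| ≤ S := by
    intro j hj
    rw [← hv j hj, Polynomial.eval_sub, hPv j hj, hTe]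
    refine (hf.taylor _ hx₀ _ (hmem j hj)).trans ?_
    rw [hv j hj, add_sub_cancel_left, abs_mul, mul_pow]
    have : |(j : ℝ)| ^ 4 ≤ 81 := by interval_cases j <;> norm_num
    have := mul_le_mul_of_nonneg_right this (by positivity : 0 ≤ B * |δ| ^ 4)
    simp only [S]
    linarith
  have h0 : (P - T).eval x₀ = 0 := by
    have := hPv 0 (by norm_num)
    rw [hv 0 (by norm_num)] at this
    simp only [Nat.cast_zero, zero_mul, add_zero] at this
    rw [Polynomial.eval_sub, this, hT0, sub_self]
  have h1 := hQv 1 (by norm_num)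
  have h2 := hQv 2 (by norm_num)
  have h3 := hQv 3 (by norm_num)
  have hR := hf.taylor _ hx₀ _ hx
  rw [← hTe] at hR
  have e : ∀ x, (P - T).eval x = _ := fun x => (cubic_taylor hQ x₀ x).1
  have hfin : P.eval (x₀ - θ * δ) - f (x₀ - θ * δ) =
      (P - T).eval (x₀ - θ * δ) - (f (x₀ - θ * δ) - T.eval (x₀ - θ * δ)) := by
    rw [Polynomial.eval_sub]; ring
  rw [hfin]
  rw [e, h0] at h1 h2 h3
  rw [e (x₀ - θ * δ), h0]
  rw [show x₀ - θ * δ - x₀ = -(θ * δ) by ring] at hR ⊢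
  rw [abs_neg, abs_mul, abs_of_nonneg hθ₀, mul_pow] at hR
  have hθ4 : θ ^ 4 ≤ θ := pow_le_of_le_one hθ₀ hθ₁ (by norm_num)
  have hR' := mul_le_mul_of_nonneg_left
    (mul_le_mul_of_nonneg_right hθ4 (by positivity : 0 ≤ |δ| ^ 4)) hB
  generalize (Polynomial.derivative^[1] (P - T)).eval x₀ = u at *
  generalize (Polynomial.derivative^[2] (P - T)).eval x₀ = w at *
  generalize (Polynomial.derivative^[3] (P - T)).eval x₀ = z at *
  -- the values at the other three nodes determine the coefficients
  set q₁ := 0 + u * (x₀ + (1 : ℕ) * δ - x₀) + w / 2 * (x₀ + (1 : ℕ) * δ - x₀) ^ 2 +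
    z / 6 * (x₀ + (1 : ℕ) * δ - x₀) ^ 3 with hq₁
  set q₂ := 0 + u * (x₀ + (2 : ℕ) * δ - x₀) + w / 2 * (x₀ + (2 : ℕ) * δ - x₀) ^ 2 +
    z / 6 * (x₀ + (2 : ℕ) * δ - x₀) ^ 3 with hq₂
  set q₃ := 0 + u * (x₀ + (3 : ℕ) * δ - x₀) + w / 2 * (x₀ + (3 : ℕ) * δ - x₀) ^ 2 +
    z / 6 * (x₀ + (3 : ℕ) * δ - x₀) ^ 3 with hq₃
  push_cast at hq₁ hq₂ hq₃
  have key : 0 + u * -(θ * δ) + w / 2 * (-(θ * δ)) ^ 2 + z / 6 * (-(θ * δ)) ^ 3 =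
      θ * (-(3 * q₁ - 3 / 2 * q₂ + q₃ / 3) + θ * (-(5 / 2) * q₁ + 2 * q₂ - q₃ / 2) -
        θ ^ 2 * ((q₃ - 3 * q₂ + 3 * q₁) / 6)) := by
    rw [hq₁, hq₂, hq₃]; ring
  rw [key]
  refine (abs_sub _ _).trans ?_
  have hu : |3 * q₁ - 3 / 2 * q₂ + q₃ / 3| ≤ 5 * S := by
    rw [abs_le] at *; constructor <;> linarith
  have hw : |-(5 / 2) * q₁ + 2 * q₂ - q₃ / 2| ≤ 5 * S := by
    rw [abs_le] at *; constructor <;> linarith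
  have hz : |(q₃ - 3 * q₂ + 3 * q₁) / 6| ≤ 2 * S := by
    rw [abs_le] at *; constructor <;> linarith
  -- the bound is `14 * 81 = 1134` for this part, and the Taylor remainder of `f` adds one
  have hsum : ∀ {x y z : ℝ}, |x| ≤ 5 * S → |y| ≤ 5 * S → |z| ≤ 2 * S →
      |-x + θ * y - θ ^ 2 * z| ≤ 14 * S := by
    intro x y z hx hy hz
    have a1 := abs_sub (-x + θ * y) (θ ^ 2 * z)
    have a2 := abs_add_le (-x) (θ * y)
    rw [abs_mul, abs_of_nonneg (sq_nonneg θ)] at a1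
    rw [abs_mul, abs_of_nonneg hθ₀, abs_neg] at a2
    have a3 : θ * |y| ≤ |y| := mul_le_of_le_one_left (abs_nonneg _) hθ₁
    have a4 : θ ^ 2 * |z| ≤ |z| :=
      mul_le_of_le_one_left (abs_nonneg _) (pow_le_one₀ hθ₀ hθ₁)
    linarith [abs_nonneg z]
  have h4 := mul_le_mul_of_nonneg_left (hsum hu hw hz) hθ₀
  rw [abs_mul, abs_of_nonneg hθ₀]
  simp only [S] at h4
  linarith

section grid

variable {a b : ℝ} {N : ℕ}

/-! ### The uniform grid -/

theorem mesh_pos (hab : a < b) (hN : 0 < N) : 0 < mesh a b N :=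
  div_pos (sub_pos.2 hab) (Nat.cast_pos.2 hN)

theorem node_add (k j : ℕ) : node a b N (k + j) = node a b N k + j * mesh a b N := by
  simp only [node, Nat.cast_add]; ring

theorem node_succ (k : ℕ) : node a b N (k + 1) = node a b N k + mesh a b N := by
  simp [node_add]

theorem node_zero : node a b N 0 = a := by simp [node]

theorem node_last (hN : 0 < N) : node a b N N = b := by
  have : (N : ℝ) ≠ 0 := (Nat.cast_pos.2 hN).ne'
  simp only [node, mesh]
  field_simp
  ring

theorem node_lt_iff (hab : a < b) (hN : 0 < N) {i j : ℕ} :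
    node a b N i < node a b N j ↔ i < j := by
  simp only [node, add_lt_add_iff_left, mul_lt_mul_iff_left₀ (mesh_pos hab hN), Nat.cast_lt]

theorem node_mem (hab : a < b) (hN : 0 < N) {k : ℕ} (hk : k ≤ N) : node a b N k ∈ Icc a b := by
  have hm := mesh_pos hab hN
  constructor
  · simp only [node]
    nlinarith [(Nat.cast_nonneg k : (0 : ℝ) ≤ k)]
  · refine le_of_le_of_eq (not_lt.1 fun h => ?_) (node_last (a := a) hN)
    exact absurd ((node_lt_iff hab hN).1 h) (not_lt.2 hk)

theorem exists_lipschitz {f : ℝ → ℝ} (hf : ContDiff ℝ 4 f) (a b : ℝ) : ∃ L : ℝ, 0 ≤ L ∧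
    ∀ x ∈ Icc a b, ∀ y ∈ Icc a b, |f x - f y| ≤ L * |x - y| := by
  obtain ⟨B, hB⟩ := (isCompact_Icc (a := a) (b := b)).exists_bound_of_continuousOn
    (hf.continuous_deriv (by norm_num)).continuousOn
  refine ⟨max B 0, le_max_right _ _, fun x hx y hy => ?_⟩
  exact (convex_Icc a b).norm_image_sub_le_of_norm_deriv_le
    (fun z _ => (hf.differentiable (by norm_num)) z)
    (fun z hz => (hB z hz).trans (le_max_left _ _)) hy hx

/-- The spline on the whole grid is an approximation of fourth order. -/
theorem exists_abs_gridSpline_sub_le (hab : a < b) {f : ℝ → ℝ} (hf : ContDiffOn ℝ 4 f (Icc a b)) :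
    ∃ C Δ₀ : ℝ, 0 ≤ C ∧ 0 < Δ₀ ∧ ∀ N : ℕ, 0 < N → mesh a b N < Δ₀ → ∀ x ∈ Icc a b,
      |gridSpline a b N f x - f x| ≤ C * mesh a b N ^ 4 := by
  obtain ⟨F, hF, hFf⟩ := exists_contDiff_eqOn hab 4 (by exact_mod_cast hf)
  obtain ⟨B, f₁, f₂, f₃, hB, hT⟩ := exists_taylorBound (f := F) (by exact_mod_cast hF) a b
  refine ⟨51 * B, (b - a) / 3, by positivity, by linarith, fun N hN hΔ x hx => ?_⟩
  have hm := mesh_pos hab hN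
  have hN3 : 3 < N := by
    have h1 : (N : ℝ) * mesh a b N = b - a := by
      have := node_last (a := a) (b := b) hN
      simp only [node] at this
      linarith
    by_contra h
    have : (N : ℝ) ≤ 3 := by exact_mod_cast not_lt.1 h
    nlinarith
  obtain ⟨n, rfl⟩ : ∃ n, N = n + 3 := ⟨N - 3, by omega⟩
  have ht : ∀ k < n + 3, node a b (n + 3) k < node a b (n + 3) (k + 1) := fun k _ =>
    (node_lt_iff hab hN).2 (Nat.lt_succ_self k)
  have hstep : ∀ k, node a b (n + 3) (k + 1) - node a b (n + 3) k = mesh a b (n + 3) := fun k => by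
    rw [node_succ]; ring
  have hfirst : node a b (n + 3) 1 - node a b (n + 3) 0 ≤
      node a b (n + 3) 2 - node a b (n + 3) 1 := by
    rw [hstep 0, hstep 1]
  have hlast : node a b (n + 3) (n + 3) - node a b (n + 3) (n + 2) ≤
      node a b (n + 3) (n + 2) - node a b (n + 3) (n + 1) := by
    rw [hstep (n + 1), hstep (n + 2)]
  have hmem : ∀ k ≤ n + 3, node a b (n + 3) k ∈ Icc a b := fun k hk => node_mem hab hN hk
  have hex := exists_isNotAKnotSpline ht hfirst hlast (fun k => f (node a b (n + 3) k))
  have hs : IsNotAKnotSpline (n + 3) (node a b (n + 3)) (fun k => f (node a b (n + 3) k))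
      (gridSpline a b (n + 3) f) := by
    simp only [gridSpline, notAKnotSpline, dif_pos hex]
    exact hex.choose_spec
  have := abs_spline_sub_le (A := 0) (D := mesh a b (n + 3)) ht hfirst hlast
    (fun k _ => (hstep k).le) hmem le_rfl hB hT hs
    (fun k _ hk => (hFf (hmem k hk.le)).symm) (by simp [hFf (hmem 0 (by omega))])
    (by simp [hFf (hmem (n + 3) le_rfl)]) x (by rwa [node_zero, node_last hN])
  rw [hFf hx] at this
  simpa using this

/-! ### The first and the last grid point over a hole -/

/-- On a fine grid there are at least five grid points over a hole, the first and the last of them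
are within one step of its ends, and there is a further grid point on either side. -/
theorem Hole.idx_spec (hab : a < b) (hN : 0 < N) {H : Hole} (ha : a < H.c) (hb : H.d < b)
    (hΔ : 8 * mesh a b N < H.d - H.c) :
    1 ≤ H.firstIdx a b N ∧ H.lastIdx a b N + 1 ≤ N ∧ H.firstIdx a b N + 4 ≤ H.lastIdx a b N ∧
    H.c < node a b N (H.firstIdx a b N) ∧
    node a b N (H.firstIdx a b N) - mesh a b N ≤ H.c ∧
    node a b N (H.lastIdx a b N) < H.d ∧
    H.d ≤ node a b N (H.lastIdx a b N) + mesh a b N := by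
  have hm := mesh_pos hab hN
  set S := {k | k ≤ N ∧ node a b N k ∈ Ioo H.c H.d} with hS
  have hne : S.Nonempty := by
    refine ⟨⌊(H.c - a) / mesh a b N⌋₊ + 1, ?_⟩
    have h1 := Nat.floor_le (div_nonneg (sub_pos.2 ha).le hm.le)
    have h2 := Nat.lt_floor_add_one ((H.c - a) / mesh a b N)
    rw [le_div_iff₀ hm] at h1
    rw [div_lt_iff₀ hm] at h2
    have h3 : node a b N (⌊(H.c - a) / mesh a b N⌋₊ + 1) ∈ Ioo H.c H.d := by
      simp only [node, Nat.cast_add, Nat.cast_one]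
      constructor <;> nlinarith
    refine ⟨?_, h3⟩
    exact ((node_lt_iff hab hN).1 ((h3.2.trans hb).trans_eq (node_last hN).symm)).le
  have hbdd : BddAbove S := ⟨N, fun k hk => hk.1⟩
  have hn : H.firstIdx a b N ∈ S := Nat.sInf_mem hne
  have hmS : H.lastIdx a b N ∈ S := Nat.sSup_mem hne hbdd
  have hn' : ∀ k ∈ S, H.firstIdx a b N ≤ k := fun k hk => Nat.sInf_le hk
  have hm' : ∀ k ∈ S, k ≤ H.lastIdx a b N := fun k hk => le_csSup hbdd hk
  generalize H.firstIdx a b N = n at *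
  generalize H.lastIdx a b N = m at *
  have n1 : 1 ≤ n := by
    by_contra h
    obtain rfl : n = 0 := by omega
    have := hn.2.1
    rw [node_zero] at this
    linarith
  have mN : m + 1 ≤ N :=
     (node_lt_iff hab hN).1 ((hmS.2.2.trans hb).trans_eq (node_last hN).symm)
  have nc : node a b N n - mesh a b N ≤ H.c := by
    by_contra! h
    have e : node a b N (n - 1) = node a b N n - mesh a b N := by
      obtain ⟨j, rfl⟩ : ∃ j, n = j + 1 := ⟨n - 1, by omega⟩
      rw [node_succ, Nat.add_sub_cancel]; ring
    have := hn' (n - 1) ⟨by have := hn.1; omega, by rwa [e], by rw [e]; linarith [hn.2.2]⟩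
    omega
  have md : H.d ≤ node a b N m + mesh a b N := by
    by_contra! h
    rw [← node_succ] at h
    have := hm' (m + 1) ⟨mN, hmS.2.1.trans ((node_lt_iff hab hN).2 (Nat.lt_succ_self m)), h⟩
    omega
  refine ⟨n1, mN, ?_, hn.2.1, nc, hmS.2.2, md⟩
  -- the grid points over the hole leave at most one step at either end uncovered
  by_contra! h
  have : (m : ℝ) ≤ n + 4 := by exact_mod_cast (by omega : m ≤ n + 4)
  have h5 := mul_le_mul_of_nonneg_right this hm.le
  simp only [node] at nc md
  linarith

/-! ### The approximate points of change of topology -/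

/-- Let `w` be increasing with slope at least `l` and let `q` be close to `w`. If `q` has a zero,
then it is close to the zero `c` of `w`. If it has none but is positive at the right end point,
then `c` is close to the left end point. -/
theorem abs_crossing_sub_le {w q : ℝ → ℝ} {c r p l E : ℝ} (hl : 0 < l) (hrp : r ≤ p)
    (hc : c ∈ Icc r p) (hw : ∀ x ∈ Icc r p, ∀ y ∈ Icc r p, x ≤ y → l * (y - x) ≤ w y - w x)
    (hwc : w c = 0) (hq : ContinuousOn q (Icc r p)) (hqp : 0 < q p)
    (hE : ∀ x ∈ Icc r p, |q x - w x| ≤ E) :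
    (∀ z ∈ Icc r p, q z = 0 → |z - c| ≤ E / l) ∧
    ((∀ z ∈ Icc r p, q z ≠ 0) → |r - c| ≤ E / l) := by
  constructor
  · intro z hz hqz
    have h := hE z hz
    rw [hqz, zero_sub, abs_neg] at h
    rw [le_div_iff₀ hl]
    rcases le_total z c with hzc | hzc
    · have := hw z hz c hc hzc
      rw [abs_sub_comm, abs_of_nonneg (sub_nonneg.2 hzc)]
      linarith [neg_abs_le (w z)]
    · have := hw c hc z hz hzc
      rw [abs_of_nonneg (sub_nonneg.2 hzc)]
      linarith [le_abs_self (w z)]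
  · intro hne
    have hr : r ∈ Icc r p := ⟨le_rfl, hrp⟩
    have hqr : 0 < q r := by
      by_contra! h
      obtain ⟨z, hz, hz0⟩ := intermediate_value_Icc hrp hq ⟨h, hqp.le⟩
      exact hne z hz hz0
    have h := hE r hr
    have := hw r hr c hc hc.1
    rw [le_div_iff₀ hl, abs_sub_comm, abs_of_nonneg (sub_nonneg.2 hc.1)]
    rw [abs_le] at h
    linarith

/-- A function with positive derivative at `c` grows at a positive rate near `c`. -/
theorem exists_growth {w : ℝ → ℝ} (hw : ContDiff ℝ 1 w) {c : ℝ} (hc : 0 < deriv w c) :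
    ∃ l ρ : ℝ, 0 < l ∧ 0 < ρ ∧ ∀ x ∈ Icc (c - ρ) (c + ρ), ∀ y ∈ Icc (c - ρ) (c + ρ), x ≤ y →
      l * (y - x) ≤ w y - w x := by
  have hcont : ContinuousAt (deriv w) c := (hw.continuous_deriv le_rfl).continuousAt
  obtain ⟨ρ, hρ, h⟩ := Metric.eventually_nhds_iff.1
    (hcont.eventually (lt_mem_nhds (half_lt_self hc)))
  refine ⟨deriv w c / 2, ρ / 2, half_pos hc, half_pos hρ, fun x hx y hy hxy => ?_⟩
  refine (convex_Icc (c - ρ / 2) (c + ρ / 2)).mul_sub_le_image_sub_of_le_deriv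
    hw.continuous.continuousOn (hw.differentiable (by norm_num)).differentiableOn
    (fun z hz => (h ?_).le) x hx y hy hxy
  rw [interior_Icc] at hz
  rw [Real.dist_eq, abs_lt]
  constructor <;> linarith [hz.1, hz.2]

/-! ### The approximate boundaries of a hole -/

theorem Hole.node_mem_Icc (hab : a < b) (hN : 0 < N) {H : Hole} (ha : a < H.c) (hb : H.d < b)
    (hΔ : 8 * mesh a b N < H.d - H.c) {k : ℕ} (hk : H.firstIdx a b N ≤ k)
    (hk' : k ≤ H.lastIdx a b N) : node a b N k ∈ Icc H.c H.d := by
  obtain ⟨-, -, -, h1, -, h2, -⟩ := H.idx_spec hab hN ha hb hΔ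
  refine ⟨h1.le.trans ?_, le_trans ?_ h2.le⟩ <;>
  exact not_lt.1 fun h => absurd ((node_lt_iff hab hN).1 h) (not_lt.2 ‹_›)

theorem Hole.abs_leftCubic_sub_le (hab : a < b) (hN : 0 < N) {H : Hole} (ha : a < H.c)
    (hb : H.d < b) (hΔ : 8 * mesh a b N < H.d - H.c) {B : ℝ} {f F f₁ f₂ f₃ : ℝ → ℝ} (hB : 0 ≤ B)
    (hF : TaylorBound a b B F f₁ f₂ f₃) (hFf : EqOn F f (Icc H.c H.d)) :
    ∀ z ∈ Icc (node a b N (H.firstIdx a b N) - mesh a b N) (node a b N (H.firstIdx a b N)),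
      |(H.leftCubic a b N f).eval z - F z| ≤
        1135 * B * ((node a b N (H.firstIdx a b N) - z) * mesh a b N ^ 3) := by
  obtain ⟨h1, h2, h3, -⟩ := H.idx_spec hab hN ha hb hΔ
  have hm := mesh_pos hab hN
  intro z hz
  set x₀ := node a b N (H.firstIdx a b N) with hx₀
  have hz' : z = x₀ - (x₀ - z) / mesh a b N * mesh a b N := by field_simp; ring
  have hlow : a ≤ x₀ - mesh a b N := by
    have := (node_mem hab hN (k := H.firstIdx a b N - 1) (by omega)).1
    have e := node_succ (a := a) (b := b) (N := N) (H.firstIdx a b N - 1)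
    rw [Nat.sub_add_cancel h1] at e
    linarith
  have hmem : ∀ j < 4, node a b N (H.firstIdx a b N + j) ∈ Icc a b := fun j hj =>
    node_mem hab hN (by omega)
  have key := abs_sub_cubicInterp_le (θ := (x₀ - z) / mesh a b N) (x₀ := x₀)
    (v := fun j => node a b N (H.firstIdx a b N + j)) (g := f) hB hF
    hm.ne' (fun j _ => node_add _ j) hmem
    (fun j hj => (hFf (H.node_mem_Icc hab hN ha hb hΔ (by omega) (by omega))).symm)
    (div_nonneg (sub_nonneg.2 hz.2) hm.le) ((div_le_one hm).2 (by linarith [hz.1]))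
    (by rw [← hz']; exact ⟨hlow.trans hz.1, hz.2.trans (hmem 0 (by norm_num)).2⟩)
  rw [← hz', abs_of_pos hm] at key
  refine key.trans_eq ?_
  field_simp

theorem Hole.abs_rightCubic_sub_le (hab : a < b) (hN : 0 < N) {H : Hole} (ha : a < H.c)
    (hb : H.d < b) (hΔ : 8 * mesh a b N < H.d - H.c) {B : ℝ} {f F f₁ f₂ f₃ : ℝ → ℝ} (hB : 0 ≤ B)
    (hF : TaylorBound a b B F f₁ f₂ f₃) (hFf : EqOn F f (Icc H.c H.d)) :
    ∀ z ∈ Icc (node a b N (H.lastIdx a b N)) (node a b N (H.lastIdx a b N) + mesh a b N),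
      |(H.rightCubic a b N f).eval z - F z| ≤
        1135 * B * ((z - node a b N (H.lastIdx a b N)) * mesh a b N ^ 3) := by
  obtain ⟨h1, h2, h3, -⟩ := H.idx_spec hab hN ha hb hΔ
  have hm := mesh_pos hab hN
  intro z hz
  set x₀ := node a b N (H.lastIdx a b N) with hx₀
  have hz' : z = x₀ - (z - x₀) / mesh a b N * -mesh a b N := by field_simp; ring
  have hhigh : x₀ + mesh a b N ≤ b := by
    rw [← node_succ]
    exact (node_mem hab hN h2).2
  have hmem : ∀ j < 4, node a b N (H.lastIdx a b N - j) ∈ Icc a b := fun j hj =>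
    node_mem hab hN (by omega)
  have key := abs_sub_cubicInterp_le (θ := (z - x₀) / mesh a b N) (x₀ := x₀)
    (v := fun j => node a b N (H.lastIdx a b N - j)) (g := f) hB hF
    (neg_ne_zero.2 hm.ne') (fun j hj => by
      have := node_add (a := a) (b := b) (N := N) (H.lastIdx a b N - j) j
      rw [Nat.sub_add_cancel (by omega)] at this
      linarith) hmem
    (fun j hj => (hFf (H.node_mem_Icc hab hN ha hb hΔ (by omega) (by omega))).symm)
    (div_nonneg (sub_nonneg.2 hz.1) hm.le) ((div_le_one hm).2 (by linarith [hz.2]))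
    (by rw [← hz']; exact ⟨(hmem 0 (by norm_num)).1.trans hz.1, hz.2.trans hhigh⟩)
  rw [← hz', abs_neg, abs_of_pos hm] at key
  refine key.trans_eq ?_
  field_simp

/-- The approximate point of change of topology is strictly to the left of the first grid point over
the hole, and it approximates the exact one with fourth order. -/
theorem Hole.cTilde_spec (hab : a < b) (hN : 0 < N) {H : Hole} (hC : H.IsC4 a b)
    (hΔ : 8 * mesh a b N < H.d - H.c) {B l ρ : ℝ} {F f₁ f₂ f₃ G g₁ g₂ g₃ : ℝ → ℝ} (hB : 0 ≤ B)
    (hF : TaylorBound a b B F f₁ f₂ f₃) (hFg : EqOn F H.g (Icc H.c H.d))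
    (hG : TaylorBound a b B G g₁ g₂ g₃) (hGh : EqOn G H.h (Icc H.c H.d)) (hl : 0 < l)
    (hρ : mesh a b N ≤ ρ)
    (hgrow : ∀ x ∈ Icc (H.c - ρ) (H.c + ρ), ∀ y ∈ Icc (H.c - ρ) (H.c + ρ), x ≤ y →
      l * (y - x) ≤ (G y - F y) - (G x - F x)) :
    H.cTilde a b N ∈ Ico (node a b N (H.firstIdx a b N) - mesh a b N)
      (node a b N (H.firstIdx a b N)) ∧
    |H.cTilde a b N - H.c| ≤ 2270 * B / l * mesh a b N ^ 4 := by
  obtain ⟨-, -, -, h1, h2, -⟩ := H.idx_spec hab hN hC.a_lt hC.lt_b hΔ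
  have hm := mesh_pos hab hN
  have eF := H.abs_leftCubic_sub_le hab hN hC.a_lt hC.lt_b hΔ hB hF hFg
  have eG := H.abs_leftCubic_sub_le hab hN hC.a_lt hC.lt_b hΔ hB hG hGh
  set p := node a b N (H.firstIdx a b N) with hp
  have hpd : p ∈ Ioo H.c H.d := ⟨h1, by linarith⟩
  have hpp : p ∈ Icc (p - mesh a b N) p := ⟨by linarith, le_rfl⟩
  have hcub : (H.leftCubic a b N H.g).eval p < (H.leftCubic a b N H.h).eval p := by
    have h3 := eF p hpp
    have h4 := eG p hpp
    simp only [sub_self, zero_mul, mul_zero, abs_nonpos_iff, sub_eq_zero] at h3 h4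
    rw [h3, h4, hFg (Ioo_subset_Icc_self hpd), hGh (Ioo_subset_Icc_self hpd)]
    exact hC.g_lt_h p hpd
  have hcc : H.c ∈ Icc H.c H.d := ⟨le_rfl, hC.c_lt_d.le⟩
  obtain ⟨k1, k2⟩ := abs_crossing_sub_le (w := fun x => G x - F x)
    (q := fun x => (H.leftCubic a b N H.h).eval x - (H.leftCubic a b N H.g).eval x)
    (c := H.c) (r := p - mesh a b N) (p := p) (l := l) (E := 2270 * B * mesh a b N ^ 4) hl
    (by linarith) ⟨h2, h1.le⟩
    (fun x hx y hy hxy => hgrow x ⟨by linarith [hx.1], by linarith [hx.2]⟩ y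
      ⟨by linarith [hy.1], by linarith [hy.2]⟩ hxy)
    (by rw [hFg hcc, hGh hcc, hC.left_eq, sub_self]) (by fun_prop) (sub_pos.2 hcub)
    (fun x hx => by
      have h3 := eF x hx
      have h4 := eG x hx
      have h5 : 1135 * B * ((p - x) * mesh a b N ^ 3) ≤ 1135 * B * mesh a b N ^ 4 := by
        have : (p - x) * mesh a b N ^ 3 ≤ mesh a b N * mesh a b N ^ 3 :=
          mul_le_mul_of_nonneg_right (by linarith [hx.1]) (by positivity)
        calc _ ≤ 1135 * B * (mesh a b N * mesh a b N ^ 3) :=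
              mul_le_mul_of_nonneg_left this (by positivity)
          _ = _ := by ring
      rw [abs_le] at *
      constructor <;> linarith)
  have hE : 2270 * B * mesh a b N ^ 4 / l = 2270 * B / l * mesh a b N ^ 4 := by ring
  rw [hE] at k1 k2
  unfold Hole.cTilde
  split_ifs with hz
  · obtain ⟨hz1, hz2⟩ := hz.choose_spec
    refine ⟨⟨hz1.1, lt_of_le_of_ne hz1.2 fun h => ?_⟩, k1 _ hz1 (sub_eq_zero.2 hz2.symm)⟩
    rw [h] at hz2
    exact hcub.ne hz2
  · refine ⟨⟨le_rfl, by linarith⟩, k2 fun z hz1 hz2 => hz ⟨z, hz1, (sub_eq_zero.1 hz2).symm⟩⟩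

/-- The counterpart of `Hole.cTilde_spec` at the right end of the hole. -/
theorem Hole.dTilde_spec (hab : a < b) (hN : 0 < N) {H : Hole} (hC : H.IsC4 a b)
    (hΔ : 8 * mesh a b N < H.d - H.c) {B l ρ : ℝ} {F f₁ f₂ f₃ G g₁ g₂ g₃ : ℝ → ℝ} (hB : 0 ≤ B)
    (hF : TaylorBound a b B F f₁ f₂ f₃) (hFg : EqOn F H.g (Icc H.c H.d))
    (hG : TaylorBound a b B G g₁ g₂ g₃) (hGh : EqOn G H.h (Icc H.c H.d)) (hl : 0 < l)
    (hρ : mesh a b N ≤ ρ)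
    (hgrow : ∀ x ∈ Icc (H.d - ρ) (H.d + ρ), ∀ y ∈ Icc (H.d - ρ) (H.d + ρ), x ≤ y →
      l * (y - x) ≤ (F y - G y) - (F x - G x)) :
    H.dTilde a b N ∈ Ioc (node a b N (H.lastIdx a b N))
      (node a b N (H.lastIdx a b N) + mesh a b N) ∧
    |H.dTilde a b N - H.d| ≤ 2270 * B / l * mesh a b N ^ 4 := by
  obtain ⟨-, -, -, -, -, h1, h2⟩ := H.idx_spec hab hN hC.a_lt hC.lt_b hΔ
  have hm := mesh_pos hab hN
  have eF := H.abs_rightCubic_sub_le hab hN hC.a_lt hC.lt_b hΔ hB hF hFg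
  have eG := H.abs_rightCubic_sub_le hab hN hC.a_lt hC.lt_b hΔ hB hG hGh
  set p := node a b N (H.lastIdx a b N) with hp
  have hpd : p ∈ Ioo H.c H.d := ⟨by linarith, h1⟩
  have hpp : p ∈ Icc p (p + mesh a b N) := ⟨le_rfl, by linarith⟩
  have hcub : (H.rightCubic a b N H.g).eval p < (H.rightCubic a b N H.h).eval p := by
    have h3 := eF p hpp
    have h4 := eG p hpp
    simp only [sub_self, zero_mul, mul_zero, abs_nonpos_iff, sub_eq_zero] at h3 h4
    rw [h3, h4, hFg (Ioo_subset_Icc_self hpd), hGh (Ioo_subset_Icc_self hpd)]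
    exact hC.g_lt_h p hpd
  have hdd : H.d ∈ Icc H.c H.d := ⟨hC.c_lt_d.le, le_rfl⟩
  -- the reflection in the origin turns the right end of the hole into a left end
  obtain ⟨k1, k2⟩ := abs_crossing_sub_le (w := fun x => G (-x) - F (-x))
    (q := fun x => (H.rightCubic a b N H.h).eval (-x) - (H.rightCubic a b N H.g).eval (-x))
    (c := -H.d) (r := -(p + mesh a b N)) (p := -p) (l := l) (E := 2270 * B * mesh a b N ^ 4) hl
    (by linarith) ⟨by linarith, by linarith⟩
    (fun x hx y hy hxy => by
      have := hgrow (-y) ⟨by linarith [hy.2], by linarith [hy.1]⟩ (-x)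
        ⟨by linarith [hx.2], by linarith [hx.1]⟩ (by linarith)
      linarith)
    (by rw [neg_neg, hFg hdd, hGh hdd, hC.right_eq, sub_self]) (by fun_prop)
    (by simpa using hcub)
    (fun x hx => by
      have hx' : -x ∈ Icc p (p + mesh a b N) := ⟨by linarith [hx.2], by linarith [hx.1]⟩
      have h3 := eF (-x) hx'
      have h4 := eG (-x) hx'
      have h5 : 1135 * B * ((-x - p) * mesh a b N ^ 3) ≤ 1135 * B * mesh a b N ^ 4 := by
        have : (-x - p) * mesh a b N ^ 3 ≤ mesh a b N * mesh a b N ^ 3 :=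
          mul_le_mul_of_nonneg_right (by linarith [hx.1]) (by positivity)
        calc _ ≤ 1135 * B * (mesh a b N * mesh a b N ^ 3) :=
              mul_le_mul_of_nonneg_left this (by positivity)
          _ = _ := by ring
      rw [abs_le] at *
      constructor <;> linarith)
  have hE : 2270 * B * mesh a b N ^ 4 / l = 2270 * B / l * mesh a b N ^ 4 := by ring
  have hneg : ∀ x y : ℝ, |x - y| = |-x - -y| := fun x y => by
    rw [abs_sub_comm]; congr 1; ring
  rw [hE] at k1 k2
  unfold Hole.dTilde
  split_ifs with hz
  · obtain ⟨hz1, hz2⟩ := hz.choose_spec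
    refine ⟨⟨lt_of_le_of_ne hz1.1 fun h => ?_, hz1.2⟩, ?_⟩
    · rw [← h] at hz2
      exact hcub.ne hz2
    · rw [hneg]
      exact k1 _ ⟨neg_le_neg hz1.2, neg_le_neg hz1.1⟩ (by simpa using sub_eq_zero.2 hz2.symm)
  · refine ⟨⟨by linarith, le_rfl⟩, ?_⟩
    rw [hneg]
    exact k2 fun z hz1 hz2 => hz ⟨-z, ⟨by linarith [hz1.2], by linarith [hz1.1]⟩,
      (sub_eq_zero.1 hz2).symm⟩

/-- The error of the splines that approximate the boundary of a hole. -/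
theorem Hole.abs_boundarySpline_sub_le (hab : a < b) (hN : 0 < N) {H : Hole} (ha : a < H.c)
    (hb : H.d < b) (hΔ : 8 * mesh a b N < H.d - H.c) {B : ℝ} {f F f₁ f₂ f₃ : ℝ → ℝ} (hB : 0 ≤ B)
    (hF : TaylorBound a b B F f₁ f₂ f₃) (hFf : EqOn F f (Icc H.c H.d))
    (hc : H.cTilde a b N ∈ Ico (node a b N (H.firstIdx a b N) - mesh a b N)
      (node a b N (H.firstIdx a b N)))
    (hd : H.dTilde a b N ∈ Ioc (node a b N (H.lastIdx a b N))
      (node a b N (H.lastIdx a b N) + mesh a b N)) :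
    ∀ x ∈ Icc (H.cTilde a b N) (H.dTilde a b N),
      |notAKnotSpline (H.lastKnot a b N) (H.knot a b N) (H.knotValue a b N f) x - F x| ≤
        57936 * B * mesh a b N ^ 4 := by
  have hm := mesh_pos hab hN
  obtain ⟨h1, h2, h3, -⟩ := H.idx_spec hab hN ha hb hΔ
  have hin := fun k => H.node_mem_Icc hab hN ha hb hΔ (k := k)
  have eL := H.abs_leftCubic_sub_le hab hN ha hb hΔ hB hF hFf _ ⟨hc.1, hc.2.le⟩
  have eR := H.abs_rightCubic_sub_le hab hN ha hb hΔ hB hF hFf _ ⟨hd.1.le, hd.2⟩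
  obtain ⟨j, hj⟩ : ∃ j, H.lastIdx a b N = H.firstIdx a b N + (j + 1) :=
    ⟨H.lastIdx a b N - H.firstIdx a b N - 1, by omega⟩
  have hK : H.lastKnot a b N = j + 3 := by simp only [Hole.lastKnot]; omega
  have hknot0 : H.knot a b N 0 = H.cTilde a b N := by simp [Hole.knot]
  have hknot : ∀ k < j + 2, H.knot a b N (k + 1) = node a b N (H.firstIdx a b N + k) := by
    intro k hk
    simp [Hole.knot, hK, show k + 1 < j + 3 by omega]
  have hknotK : H.knot a b N (j + 3) = H.dTilde a b N := by simp [Hole.knot, hK]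
  have hval0 : H.knotValue a b N f 0 = (H.leftCubic a b N f).eval (H.cTilde a b N) := by
    simp [Hole.knotValue]
  have hval : ∀ k < j + 2, H.knotValue a b N f (k + 1) = f (node a b N (H.firstIdx a b N + k)) := by
    intro k hk
    simp [Hole.knotValue, hK, show k + 1 < j + 3 by omega]
  have hvalK : H.knotValue a b N f (j + 3) =
      (H.rightCubic a b N f).eval (H.dTilde a b N) := by simp [Hole.knotValue, hK]
  rw [hK]
  have hlastnode : H.knot a b N (j + 2) = node a b N (H.lastIdx a b N) := by
    rw [hknot (j + 1) (by omega), hj]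
  have hfirstnode : H.knot a b N 1 = node a b N (H.firstIdx a b N) := hknot 0 (by omega)
  have step0 : 0 < H.knot a b N 1 - H.knot a b N 0 ∧
      H.knot a b N 1 - H.knot a b N 0 ≤ mesh a b N := by
    rw [hfirstnode, hknot0]
    exact ⟨by linarith [hc.2], by linarith [hc.1]⟩
  have step : ∀ k < j + 1, H.knot a b N (k + 2) - H.knot a b N (k + 1) = mesh a b N := by
    intro k hk
    rw [hknot (k + 1) (by omega), hknot k (by omega), ← add_assoc, node_succ]
    ring
  have stepK : 0 < H.knot a b N (j + 3) - H.knot a b N (j + 2) ∧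
      H.knot a b N (j + 3) - H.knot a b N (j + 2) ≤ mesh a b N := by
    rw [hlastnode, hknotK]
    exact ⟨by linarith [hd.1], by linarith [hd.2]⟩
  have hsteps : ∀ k < j + 3, 0 < H.knot a b N (k + 1) - H.knot a b N k ∧
      H.knot a b N (k + 1) - H.knot a b N k ≤ mesh a b N := by
    intro k hk
    rcases Nat.eq_zero_or_pos k with rfl | h0
    · exact step0
    · rcases eq_or_ne k (j + 2) with rfl | h
      · exact stepK
      · obtain ⟨i, rfl⟩ : ∃ i, k = i + 1 := ⟨k - 1, by omega⟩
        rw [step i (by omega)]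
        exact ⟨hm, le_rfl⟩
  have ht : ∀ k < j + 3, H.knot a b N k < H.knot a b N (k + 1) := fun k hk =>
    sub_pos.1 (hsteps k hk).1
  have hfirst : H.knot a b N 1 - H.knot a b N 0 ≤ H.knot a b N 2 - H.knot a b N 1 := by
    rw [step 0 (by omega)]
    exact step0.2
  have hlast : H.knot a b N (j + 3) - H.knot a b N (j + 2) ≤
      H.knot a b N (j + 2) - H.knot a b N (j + 1) := by
    rw [step j (by omega)]
    exact stepK.2
  have hmem : ∀ k ≤ j + 3, H.knot a b N k ∈ Icc a b := by
    intro k hk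
    have n0 := node_mem hab hN (k := H.firstIdx a b N) (by omega)
    have n1 := node_mem hab hN (k := H.firstIdx a b N - 1) (by omega)
    have e := node_succ (a := a) (b := b) (N := N) (H.firstIdx a b N - 1)
    rw [Nat.sub_add_cancel h1] at e
    have m0 := node_mem hab hN (k := H.lastIdx a b N) (by omega)
    have m1 := node_mem hab hN h2
    rw [node_succ] at m1
    rcases Nat.eq_zero_or_pos k with rfl | h0
    · rw [hknot0]
      exact ⟨by linarith [hc.1, n1.1], hc.2.le.trans n0.2⟩
    · rcases eq_or_ne k (j + 3) with rfl | h
      · rw [hknotK]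
        exact ⟨m0.1.trans hd.1.le, hd.2.trans m1.2⟩
      · obtain ⟨i, rfl⟩ : ∃ i, k = i + 1 := ⟨k - 1, by omega⟩
        rw [hknot i (by omega)]
        exact node_mem hab hN (by omega)
  have hex := exists_isNotAKnotSpline ht hfirst hlast (H.knotValue a b N f)
  have hs : IsNotAKnotSpline (j + 3) (H.knot a b N) (H.knotValue a b N f)
      (notAKnotSpline (j + 3) (H.knot a b N) (H.knotValue a b N f)) := by
    simp only [notAKnotSpline, dif_pos hex]
    exact hex.choose_spec
  intro x hx
  refine (abs_spline_sub_le (A := 1135 * B) (D := mesh a b N) ht hfirst hlast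
    (fun k hk => (hsteps k hk).2) hmem (by positivity) hB hF hs (fun k h0 hk => ?_) ?_ ?_ x
    (by rwa [hknot0, hknotK])).trans_eq (by ring)
  · obtain ⟨i, rfl⟩ : ∃ i, k = i + 1 := ⟨k - 1, by omega⟩
    rw [hval i (by omega), hknot i (by omega), hFf (hin _ (by omega) (by omega))]
  · rw [step 0 (by omega), hval0, hknot0, hfirstnode]
    exact eL.trans_eq (by ring)
  · rw [step j (by omega), hvalK, hknotK, hlastnode]
    exact eR.trans_eq (by ring)

/-- The constant extension of `f` is the composition of `f` with the clamping map onto `[c, d]`. -/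
theorem extendConst_eq {c d : ℝ} (hcd : c ≤ d) (f : ℝ → ℝ) (x : ℝ) :
    extendConst c d f x = f (max c (min d x)) := by
  unfold extendConst
  split_ifs with h1 h2
  · rw [min_eq_right (h1.le.trans hcd), max_eq_left h1.le]
  · rw [min_eq_right h2, max_eq_right (not_lt.1 h1)]
  · rw [min_eq_left (not_le.1 h2).le, max_eq_right hcd]

theorem clamp_mem {c d : ℝ} (hcd : c ≤ d) (x : ℝ) : max c (min d x) ∈ Icc c d :=
  ⟨le_max_left _ _, max_le hcd (min_le_left _ _)⟩

theorem abs_clamp_sub_clamp_le {c d c' d' E : ℝ} (hc : |c - c'| ≤ E) (hd : |d - d'| ≤ E) (x : ℝ) :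
    |max c (min d x) - max c' (min d' x)| ≤ E := by
  refine (abs_max_sub_max_le_max _ _ _ _).trans (max_le hc ?_)
  refine (abs_min_sub_min_le_max _ _ _ _).trans (max_le hd ?_)
  rw [sub_self, abs_zero]
  exact (abs_nonneg _).trans hc

/-- The extended boundary functions of a hole are approximated uniformly with fourth order. -/
theorem Hole.exists_abs_approxBoundary_sub_le (hab : a < b) {H : Hole} (hC : H.IsC4 a b)
    (hT : H.IsTransversal) :
    ∃ C Δ₀ : ℝ, 0 ≤ C ∧ 0 < Δ₀ ∧ ∀ N : ℕ, 0 < N → mesh a b N < Δ₀ → ∀ x,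
      |H.approxBoundary a b N H.g x - extendConst H.c H.d H.g x| ≤ C * mesh a b N ^ 4 ∧
      |H.approxBoundary a b N H.h x - extendConst H.c H.d H.h x| ≤ C * mesh a b N ^ 4 := by
  have hcd := hC.c_lt_d
  obtain ⟨F, hF, hFg⟩ := exists_contDiff_eqOn hcd 4 (by exact_mod_cast hC.g_smooth)
  obtain ⟨G, hG, hGh⟩ := exists_contDiff_eqOn hcd 4 (by exact_mod_cast hC.h_smooth)
  replace hF : ContDiff ℝ 4 F := by exact_mod_cast hF
  replace hG : ContDiff ℝ 4 G := by exact_mod_cast hG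
  obtain ⟨B₁, f₁, f₂, f₃, hB₁, hTF⟩ := exists_taylorBound hF a b
  obtain ⟨B₂, g₁, g₂, g₃, -, hTG⟩ := exists_taylorBound hG a b
  replace hTF := hTF.mono (le_max_left B₁ B₂)
  replace hTG := hTG.mono (le_max_right B₁ B₂)
  have hB : 0 ≤ max B₁ B₂ := hB₁.trans (le_max_left _ _)
  generalize max B₁ B₂ = B at *
  obtain ⟨L₁, hL₁, hLF⟩ := exists_lipschitz hF a b
  obtain ⟨L₂, hL₂, hLG⟩ := exists_lipschitz hG a b
  have hderiv : ∀ x ∈ Icc H.c H.d, derivWithin (fun x => H.h x - H.g x) (Icc H.c H.d) x =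
      deriv (fun x => G x - F x) x := by
    intro x hx
    rw [derivWithin_congr (f := fun x => G x - F x) (fun z hz => by simp only [hFg hz, hGh hz])
      (by simp only [hFg hx, hGh hx])]
    exact (((hG.sub hF).differentiable (by norm_num)) x).derivWithin (uniqueDiffOn_Icc hcd x hx)
  have hGF : ContDiff ℝ 1 (fun x => G x - F x) := (hG.sub hF).of_le (by norm_num)
  have hFG : ContDiff ℝ 1 (fun x => F x - G x) := (hF.sub hG).of_le (by norm_num)
  obtain ⟨l, ρ, hl, hρ, hgrow⟩ := exists_growth hGF (c := H.c)
    (by rw [← hderiv _ ⟨le_rfl, hcd.le⟩]; exact hT.1)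
  obtain ⟨l', ρ', hl', hρ', hgrow'⟩ := exists_growth hFG (c := H.d) (by
    have h1 : (fun x => F x - G x) = fun x => -(G x - F x) := by funext x; ring
    have h2 := hT.2
    rw [hderiv _ ⟨hcd.le, le_rfl⟩] at h2
    rw [h1, deriv.fun_neg]
    linarith)
  refine ⟨57936 * B + max L₁ L₂ * max (2270 * B / l) (2270 * B / l'),
    min ((H.d - H.c) / 8) (min ρ ρ'), by positivity,
    lt_min (by linarith) (lt_min hρ hρ'), fun N hN hΔ x => ?_⟩
  have hm := mesh_pos hab hN
  have hΔ8 : 8 * mesh a b N < H.d - H.c := by linarith [hΔ.trans_le (min_le_left _ _)]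
  have hΔρ := (hΔ.trans_le ((min_le_right _ _).trans (min_le_left _ _))).le
  have hΔρ' := (hΔ.trans_le ((min_le_right _ _).trans (min_le_right _ _))).le
  obtain ⟨hc, hcE⟩ := H.cTilde_spec hab hN hC hΔ8 hB hTF hFg hTG hGh hl hΔρ hgrow
  obtain ⟨hd, hdE⟩ := H.dTilde_spec hab hN hC hΔ8 hB hTF hFg hTG hGh hl' hΔρ' hgrow'
  obtain ⟨i1, i2, i3, i4, i5, i6, i7⟩ := H.idx_spec hab hN hC.a_lt hC.lt_b hΔ8
  have hcd' : H.cTilde a b N ≤ H.dTilde a b N := by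
    have := (node_lt_iff hab hN).2 (show H.firstIdx a b N < H.lastIdx a b N by omega)
    linarith [hc.2, hd.1]
  have hE := abs_clamp_sub_clamp_le
    (hcE.trans (mul_le_mul_of_nonneg_right (le_max_left _ (2270 * B / l')) (by positivity)))
    (hdE.trans (mul_le_mul_of_nonneg_right (le_max_right (2270 * B / l) _) (by positivity))) x
  have hz := clamp_mem hcd' x
  have hw := clamp_mem hcd.le x
  have hwab : max H.c (min H.d x) ∈ Icc a b :=
    ⟨hC.a_lt.le.trans hw.1, hw.2.trans hC.lt_b.le⟩
  have hzab : max (H.cTilde a b N) (min (H.dTilde a b N) x) ∈ Icc a b := by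
    have n1 := node_mem hab hN (k := H.firstIdx a b N - 1) (by omega)
    have e := node_succ (a := a) (b := b) (N := N) (H.firstIdx a b N - 1)
    rw [Nat.sub_add_cancel i1] at e
    have m1 := node_mem hab hN i2
    rw [node_succ] at m1
    exact ⟨by linarith [hz.1, hc.1, n1.1], by linarith [hz.2, hd.2, m1.2]⟩
  have combine : ∀ {f F : ℝ → ℝ} {L : ℝ}, 0 ≤ L → L ≤ max L₁ L₂ → EqOn F f (Icc H.c H.d) →
      (∀ x ∈ Icc a b, ∀ y ∈ Icc a b, |F x - F y| ≤ L * |x - y|) →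
      (∀ x ∈ Icc (H.cTilde a b N) (H.dTilde a b N),
        |notAKnotSpline (H.lastKnot a b N) (H.knot a b N) (H.knotValue a b N f) x - F x| ≤
          57936 * B * mesh a b N ^ 4) →
      |H.approxBoundary a b N f x - extendConst H.c H.d f x| ≤
        (57936 * B + max L₁ L₂ * max (2270 * B / l) (2270 * B / l')) * mesh a b N ^ 4 := by
    intro f F L hL hL' hFf hLip hspl
    rw [Hole.approxBoundary, extendConst_eq hcd', extendConst_eq hcd.le, ← hFf hw]
    have h1 := hspl _ hz
    have h2 := hLip _ hzab _ hwab
    have h3 := mul_le_mul hL' hE (abs_nonneg _) (hL.trans hL')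
    refine (abs_sub_le _ _ _).trans ((add_le_add h1 (h2.trans h3)).trans_eq ?_)
    ring
  exact ⟨combine hL₁ (le_max_left _ _) hFg hLF
      (H.abs_boundarySpline_sub_le hab hN hC.a_lt hC.lt_b hΔ8 hB hTF hFg hc hd),
    combine hL₂ (le_max_right _ _) hGh hLG
      (H.abs_boundarySpline_sub_le hab hN hC.a_lt hC.lt_b hΔ8 hB hTG hGh hc hd)⟩

end grid

/-! ### Unions of bands -/

section bands

variable {ι : Type} {g h g' h' : ι → ℝ} {top top' bot bot' δ : ℝ} {L : List ι}

theorem isCompact_bands : IsCompact (bands g h top bot L) := by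
  induction L generalizing bot with
  | nil => exact isCompact_Icc
  | cons i L ih => exact isCompact_Icc.union ih

theorem bands_nonempty (hbt : bot ≤ top) (hbot : ∀ i ∈ L, bot ≤ g i) :
    (bands g h top bot L).Nonempty := by
  cases L with
  | nil => exact ⟨bot, le_rfl, hbt⟩
  | cons i L => exact ⟨bot, Or.inl ⟨le_rfl, hbot i List.mem_cons_self⟩⟩

/-- If the boundaries are in order, the bands are what the open intervals between `g i` and `h i`
leave of `[bot, top]`. -/
theorem bands_eq (hbt : bot ≤ top) (hbot : ∀ i ∈ L, bot ≤ g i) (htop : ∀ i ∈ L, h i ≤ top)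
    (hgh : ∀ i ∈ L, g i ≤ h i) (hL : L.Pairwise fun i j => h i ≤ g j) :
    bands g h top bot L = {y | y ∈ Icc bot top ∧ ∀ i ∈ L, y ∉ Ioo (g i) (h i)} := by
  induction L generalizing bot with
  | nil =>
    ext y
    simp [bands]
  | cons i L ih =>
    obtain ⟨hi, hL⟩ := List.pairwise_cons.1 hL
    simp only [List.forall_mem_cons] at hbot htop hgh
    rw [bands, ih htop.1 hi htop.2 hgh.2 hL]
    ext y
    simp only [mem_union, mem_ofPred_eq, List.forall_mem_cons, mem_Icc, mem_Ioo, not_and, not_lt]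
    constructor
    · rintro (⟨h1, h2⟩ | ⟨⟨h1, h2⟩, h3⟩)
      · refine ⟨⟨h1, h2.trans (hgh.1.trans htop.1)⟩, fun h4 => absurd h4 (not_lt.2 h2),
          fun j hj h4 => ?_⟩
        linarith [hi j hj, hgh.1]
      · exact ⟨⟨by linarith [hbot.1, hgh.1], h2⟩, fun _ => h1, h3⟩
    · rintro ⟨⟨h1, h2⟩, h3, h4⟩
      rcases le_or_gt y (g i) with h5 | h5
      · exact Or.inl ⟨h1, h5⟩
      · exact Or.inr ⟨⟨h3 h5, h2⟩, h4⟩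

/-- Moving the end points of all bands by at most `δ` moves the points of the union by at most `δ`.
Only the bands of the target have to be non-empty. -/
theorem exists_mem_bands_abs_sub_le (hbt : bot' ≤ top') (hbot : ∀ i ∈ L, bot' ≤ g' i)
    (htop : ∀ i ∈ L, h' i ≤ top') (hL : L.Pairwise fun i j => h' i ≤ g' j)
    (hδb : |bot - bot'| ≤ δ) (hδt : |top - top'| ≤ δ) (hδg : ∀ i ∈ L, |g i - g' i| ≤ δ)
    (hδh : ∀ i ∈ L, |h i - h' i| ≤ δ) {y : ℝ} (hy : y ∈ bands g h top bot L) :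
    ∃ y' ∈ bands g' h' top' bot' L, |y - y'| ≤ δ := by
  have move : ∀ {p q p' q' : ℝ}, y ∈ Icc p q → p' ≤ q' → |p - p'| ≤ δ → |q - q'| ≤ δ →
      ∃ y' ∈ Icc p' q', |y - y'| ≤ δ := by
    intro p q p' q' hy hpq hp hq
    refine ⟨_, clamp_mem hpq y, ?_⟩
    have := abs_clamp_sub_clamp_le hp hq y
    rwa [min_eq_right hy.2, max_eq_right hy.1] at this
  induction L generalizing bot bot' with
  | nil => exact move hy hbt hδb hδt
  | cons i L ih =>
    obtain ⟨hi, hL⟩ := List.pairwise_cons.1 hL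
    simp only [List.forall_mem_cons] at hbot htop hδg hδh
    rcases hy with hy | hy
    · obtain ⟨y', h1, h2⟩ := move hy hbot.1 hδb hδg.1
      exact ⟨y', Or.inl h1, h2⟩
    · obtain ⟨y', h1, h2⟩ := ih htop.1 hi htop.2 hL hδh.1 hδg.2 hδh.2 hy
      exact ⟨y', Or.inr h1, h2⟩

end bands

/-! ### Holes and their constant extensions -/

theorem exists_pos_forall_le {ι : Type*} [Finite ι] {δ : ι → ℝ} (hδ : ∀ i, 0 < δ i) :
    ∃ δ₀ : ℝ, 0 < δ₀ ∧ ∀ i, δ₀ ≤ δ i := by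
  cases isEmpty_or_nonempty ι
  · exact ⟨1, one_pos, fun i => isEmptyElim i⟩
  · obtain ⟨i, hi⟩ := Finite.exists_min δ
    exact ⟨δ i, hδ i, hi⟩

theorem exists_pos_le_of_isCompact {S : Set ℝ} (hS : IsCompact S) {m : ℝ → ℝ}
    (hm : ContinuousOn m S) (hpos : ∀ x ∈ S, 0 < m x) : ∃ γ : ℝ, 0 < γ ∧ ∀ x ∈ S, γ ≤ m x := by
  rcases S.eq_empty_or_nonempty with rfl | hne
  · exact ⟨1, one_pos, by simp⟩
  · obtain ⟨x, hx, hmin⟩ := hS.exists_isMinOn hne hm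
    exact ⟨m x, hpos x hx, hmin⟩

/-- A continuous function that is positive on `[C, D]`, which may be empty, is positive on a slightly
larger interval. -/
theorem exists_pos_of_thickening {C D : ℝ} {m : ℝ → ℝ} (hm : Continuous m)
    (hpos : ∀ x ∈ Icc C D, 0 < m x) :
    ∃ ε : ℝ, 0 < ε ∧ ∀ x ∈ Icc (C - ε) (D + ε), 0 < m x := by
  rcases le_or_gt C D with hCD | hCD
  · obtain ⟨δ, hδ, hsub⟩ := (isCompact_Icc (a := C) (b := D)).exists_thickening_subset_open
      (isOpen_lt continuous_const hm) hpos
    refine ⟨δ / 2, half_pos hδ, fun x hx => hsub ?_⟩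
    rw [Metric.mem_thickening_iff]
    refine ⟨_, clamp_mem hCD x, ?_⟩
    have h1 := abs_clamp_sub_clamp_le (c := C - δ / 2) (c' := C) (d := D + δ / 2) (d' := D)
      (E := δ / 2) (by rw [abs_le]; constructor <;> linarith)
      (by rw [abs_le]; constructor <;> linarith) x
    rw [min_eq_right hx.2, max_eq_right hx.1] at h1
    rw [Real.dist_eq]
    linarith
  · exact ⟨(C - D) / 4, by linarith, fun x hx => by linarith [hx.1, hx.2]⟩

theorem continuous_clamp {c d : ℝ} (hcd : c ≤ d) {f : ℝ → ℝ} (hf : ContinuousOn f (Icc c d)) :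
    Continuous fun x => f (max c (min d x)) :=
  hf.comp_continuous (by fun_prop) (clamp_mem hcd)

theorem continuous_extendConst {c d : ℝ} (hcd : c ≤ d) {f : ℝ → ℝ}
    (hf : ContinuousOn f (Icc c d)) : Continuous (extendConst c d f) := by
  rw [funext (extendConst_eq hcd f)]
  exact continuous_clamp hcd hf

theorem extendConst_of_mem {c d x : ℝ} (hx : x ∈ Icc c d) (f : ℝ → ℝ) :
    extendConst c d f x = f x := by
  rw [extendConst_eq (hx.1.trans hx.2), min_eq_right hx.2, max_eq_right hx.1]

theorem Hole.IsC4.g_le_h {a b : ℝ} {H : Hole} (hC : H.IsC4 a b) {x : ℝ} (hx : x ∈ Icc H.c H.d) :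
    H.g x ≤ H.h x := by
  rcases eq_or_lt_of_le hx.1 with h | h
  · rw [← h, hC.left_eq]
  rcases eq_or_lt_of_le hx.2 with h' | h'
  · rw [h', hC.right_eq]
  exact (hC.g_lt_h x ⟨h, h'⟩).le

theorem Hole.IsC4.extend_g_le_h {a b : ℝ} {H : Hole} (hC : H.IsC4 a b) (x : ℝ) :
    extendConst H.c H.d H.g x ≤ extendConst H.c H.d H.h x := by
  rw [extendConst_eq hC.c_lt_d.le, extendConst_eq hC.c_lt_d.le]
  exact hC.g_le_h (clamp_mem hC.c_lt_d.le x)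

theorem Hole.IsC4.mem_closure_region {a b : ℝ} {H : Hole} (hC : H.IsC4 a b) {x y : ℝ}
    (hx : x ∈ Icc H.c H.d) (hy : y ∈ Icc (H.g x) (H.h x)) : (x, y) ∈ closure H.region := by
  by_cases hx' : x ∈ Ioo H.c H.d
  · rw [← closure_Ioo (hC.g_lt_h x hx').ne] at hy
    exact map_mem_closure (f := fun y => (x, y)) (by fun_prop) hy fun z hz => ⟨hx', hz.1, hz.2⟩
  · have hgh : H.g x = H.h x := by
      rcases eq_or_lt_of_le hx.1 with h | h
      · rw [← h, hC.left_eq]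
      rcases eq_or_lt_of_le hx.2 with h' | h'
      · rw [h', hC.right_eq]
      exact absurd ⟨h, h'⟩ hx'
    have hy' : y = (H.g x + H.h x) / 2 := by linarith [hy.1, hy.2]
    have hcont : ContinuousOn (fun z => (z, (H.g z + H.h z) / 2)) (Icc H.c H.d) :=
      continuousOn_id.prodMk
        ((hC.g_smooth.continuousOn.add hC.h_smooth.continuousOn).div_const 2)
    rw [hy']
    refine ((hcont x hx).mono Ioo_subset_Icc_self).mem_closure
      (by rwa [closure_Ioo hC.c_lt_d.ne]) fun z hz => ?_
    have := hC.g_lt_h z hz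
    exact ⟨hz, by simp only; linarith, by simp only; linarith⟩

theorem disjoint_Icc_iff {p q p' q' : ℝ} (h : p ≤ q) (h' : p' ≤ q') :
    Disjoint (Icc p q) (Icc p' q') ↔ 0 < max (p' - q) (p - q') := by
  rw [lt_max_iff, sub_pos, sub_pos]
  constructor
  · intro hd
    by_contra! hn
    have h1 : max p p' ∈ Icc p q := ⟨le_max_left _ _, max_le h hn.1⟩
    exact Set.disjoint_left.1 hd h1 ⟨le_max_right _ _, max_le hn.2 h'⟩
  · rintro (h1 | h1) <;> rw [Set.disjoint_left] <;> intro y hy hy' <;>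
      linarith [hy.1, hy.2, hy'.1, hy'.2]

variable {a b : ℝ} {l u : ℝ → ℝ} {M : ℕ} {F : ℝ → Set ℝ} {H : Fin M → Hole}

theorem HasC4Holes.continuous_extend (hF : HasC4Holes a b F l u H) (i : Fin M) :
    Continuous (extendConst (H i).c (H i).d (H i).g) ∧
      Continuous (extendConst (H i).c (H i).d (H i).h) :=
  ⟨continuous_extendConst (hF.hole i).c_lt_d.le (hF.hole i).g_smooth.continuousOn,
    continuous_extendConst (hF.hole i).c_lt_d.le (hF.hole i).h_smooth.continuousOn⟩

/-- Over the holes themselves the boundaries are separated; by continuity and compactness they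
remain so over slightly larger intervals. -/
theorem HasC4Holes.exists_isAdmissible (hab : a < b) (hF : HasC4Holes a b F l u H) :
    ∃ ε : ℝ, IsAdmissible a b l u H ε := by
  have hlc := continuous_clamp hab.le hF.l_smooth.continuousOn
  have huc := continuous_clamp hab.le hF.u_smooth.continuousOn
  have hsub : ∀ i, ∀ x ∈ Icc (H i).c (H i).d, max a (min b x) = x := fun i x hx => by
    rw [min_eq_right (hx.2.trans (hF.hole i).lt_b.le),
      max_eq_right ((hF.hole i).a_lt.le.trans hx.1)]
  choose ε₁ hε₁ h₁ using fun i => exists_pos_of_thickening (C := (H i).c) (D := (H i).d)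
    (m := fun x => min (extendConst (H i).c (H i).d (H i).g x - l (max a (min b x)))
      (u (max a (min b x)) - extendConst (H i).c (H i).d (H i).h x))
    (((hF.continuous_extend i).1.sub hlc).min (huc.sub (hF.continuous_extend i).2))
    (fun x hx => by
      rw [extendConst_of_mem hx, extendConst_of_mem hx, hsub i x hx]
      exact lt_min (sub_pos.2 (hF.inside i x hx).1) (sub_pos.2 (hF.inside i x hx).2))
  choose ε₂ hε₂ h₂ using fun p : {p : Fin M × Fin M // p.2 ≠ p.1} => exists_pos_of_thickening
    (C := max (H p.1.1).c (H p.1.2).c) (D := min (H p.1.1).d (H p.1.2).d)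
    (m := fun x => max
      (extendConst (H p.1.2).c (H p.1.2).d (H p.1.2).g x -
        extendConst (H p.1.1).c (H p.1.1).d (H p.1.1).h x)
      (extendConst (H p.1.1).c (H p.1.1).d (H p.1.1).g x -
        extendConst (H p.1.2).c (H p.1.2).d (H p.1.2).h x))
    (((hF.continuous_extend p.1.2).1.sub (hF.continuous_extend p.1.1).2).max
      ((hF.continuous_extend p.1.1).1.sub (hF.continuous_extend p.1.2).2))
    (fun x hx => by
      have hx1 : x ∈ Icc (H p.1.1).c (H p.1.1).d :=
        ⟨(le_max_left _ _).trans hx.1, hx.2.trans (min_le_left _ _)⟩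
      have hx2 : x ∈ Icc (H p.1.2).c (H p.1.2).d :=
        ⟨(le_max_right _ _).trans hx.1, hx.2.trans (min_le_right _ _)⟩
      rw [extendConst_of_mem hx1, extendConst_of_mem hx1, extendConst_of_mem hx2,
        extendConst_of_mem hx2, ← disjoint_Icc_iff ((hF.hole _).g_le_h hx1)
          ((hF.hole _).g_le_h hx2), Set.disjoint_left]
      intro y hy1 hy2
      exact Set.disjoint_left.1 (hF.separated p.2.symm)
        ((hF.hole _).mem_closure_region hx1 hy1) ((hF.hole _).mem_closure_region hx2 hy2))
  obtain ⟨ε₃, hε₃, h₃⟩ := exists_pos_forall_le hε₁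
  obtain ⟨ε₄, hε₄, h₄⟩ := exists_pos_forall_le hε₂
  refine ⟨min ε₃ ε₄, lt_min hε₃ hε₄, fun i x hx hxi => ?_⟩
  have key := h₁ i x ⟨by linarith [hxi.1, h₃ i, min_le_left ε₃ ε₄],
    by linarith [hxi.2, h₃ i, min_le_left ε₃ ε₄]⟩
  rw [lt_min_iff, sub_pos, sub_pos, min_eq_right hx.2, max_eq_right hx.1] at key
  refine ⟨key.1, key.2, fun j hj hxj => ?_⟩
  rw [disjoint_Icc_iff ((hF.hole i).extend_g_le_h x) ((hF.hole j).extend_g_le_h x)]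
  have hε := (min_le_right ε₃ ε₄).trans (h₄ ⟨(i, j), hj⟩)
  refine h₂ ⟨(i, j), hj⟩ x ⟨?_, ?_⟩
  · rw [sub_le_iff_le_add]
    exact max_le (by linarith [hxi.1]) (by linarith [hxj.1])
  · rw [← sub_le_iff_le_add]
    exact le_min (by linarith [hxi.2]) (by linarith [hxj.2])

/-- For admissible `ε` the distances between different boundaries have a positive lower bound. -/
theorem HasC4Holes.exists_gap (hF : HasC4Holes a b F l u H) {ε : ℝ}
    (hε : IsAdmissible a b l u H ε) : ∃ γ : ℝ, 0 < γ ∧ ∀ x ∈ Icc a b, l x + γ ≤ u x ∧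
      ∀ i, x ∈ Icc ((H i).c - ε) ((H i).d + ε) →
        l x + γ ≤ extendConst (H i).c (H i).d (H i).g x ∧
        extendConst (H i).c (H i).d (H i).h x + γ ≤ u x ∧
        ∀ j, j ≠ i → x ∈ Icc ((H j).c - ε) ((H j).d + ε) →
          extendConst (H i).c (H i).d (H i).h x + γ ≤ extendConst (H j).c (H j).d (H j).g x ∨
          extendConst (H j).c (H j).d (H j).h x + γ ≤ extendConst (H i).c (H i).d (H i).g x := by
  have hl := hF.l_smooth.continuousOn
  have hu := hF.u_smooth.continuousOn
  obtain ⟨γ₀, hγ₀, h₀⟩ := exists_pos_le_of_isCompact isCompact_Icc (hu.sub hl)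
    (fun x hx => sub_pos.2 (hF.l_lt_u x hx))
  choose γ₁ hγ₁ h₁ using fun i => exists_pos_le_of_isCompact
    (S := Icc a b ∩ Icc ((H i).c - ε) ((H i).d + ε)) (isCompact_Icc.inter isCompact_Icc)
    (m := fun x => min (extendConst (H i).c (H i).d (H i).g x - l x)
      (u x - extendConst (H i).c (H i).d (H i).h x))
    (((hF.continuous_extend i).1.continuousOn.sub (hl.mono inter_subset_left)).inf
      ((hu.mono inter_subset_left).sub (hF.continuous_extend i).2.continuousOn))
    (fun x hx => lt_min (sub_pos.2 (hε.2 i x hx.1 hx.2).1) (sub_pos.2 (hε.2 i x hx.1 hx.2).2.1))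
  choose γ₂ hγ₂ h₂ using fun p : {p : Fin M × Fin M // p.2 ≠ p.1} => exists_pos_le_of_isCompact
    (S := (Icc a b ∩ Icc ((H p.1.1).c - ε) ((H p.1.1).d + ε)) ∩
      Icc ((H p.1.2).c - ε) ((H p.1.2).d + ε))
    ((isCompact_Icc.inter isCompact_Icc).inter isCompact_Icc)
    (m := fun x => max
      (extendConst (H p.1.2).c (H p.1.2).d (H p.1.2).g x -
        extendConst (H p.1.1).c (H p.1.1).d (H p.1.1).h x)
      (extendConst (H p.1.1).c (H p.1.1).d (H p.1.1).g x -
        extendConst (H p.1.2).c (H p.1.2).d (H p.1.2).h x))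
    (((hF.continuous_extend p.1.2).1.sub (hF.continuous_extend p.1.1).2).max
      ((hF.continuous_extend p.1.1).1.sub (hF.continuous_extend p.1.2).2)).continuousOn
    (fun x hx => (disjoint_Icc_iff ((hF.hole _).extend_g_le_h x)
      ((hF.hole _).extend_g_le_h x)).1 ((hε.2 p.1.1 x hx.1.1 hx.1.2).2.2 p.1.2 p.2 hx.2))
  obtain ⟨γ₃, hγ₃, h₃⟩ := exists_pos_forall_le hγ₁
  obtain ⟨γ₄, hγ₄, h₄⟩ := exists_pos_forall_le hγ₂
  refine ⟨min γ₀ (min γ₃ γ₄), lt_min hγ₀ (lt_min hγ₃ hγ₄), fun x hx => ⟨?_, fun i hi => ?_⟩⟩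
  · have := h₀ x hx
    simp only [Pi.sub_apply] at this
    linarith [min_le_left γ₀ (min γ₃ γ₄)]
  have le₃ : min γ₀ (min γ₃ γ₄) ≤ γ₃ := (min_le_right _ _).trans (min_le_left _ _)
  have le₄ : min γ₀ (min γ₃ γ₄) ≤ γ₄ := (min_le_right _ _).trans (min_le_right _ _)
  have k₁ := le_min_iff.1 (h₁ i x ⟨hx, hi⟩)
  have k₃ := h₃ i
  refine ⟨by linarith [k₁.1], by linarith [k₁.2], fun j hj hxj => ?_⟩
  have k₄ := h₄ ⟨(i, j), hj⟩
  rcases le_max_iff.1 (h₂ ⟨(i, j), hj⟩ x ⟨⟨hx, hi⟩, hxj⟩) with h | h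
  · left
    simp only at h
    linarith
  · right
    simp only at h
    linarith

/-- With the exact boundary functions, the bands form the given set-valued function. -/
theorem HasC4Holes.value_eq (hF : HasC4Holes a b F l u H) {ε : ℝ} (hε : 0 < ε) {x : ℝ}
    (hx : x ∈ Icc a b) : F x = {y | y ∈ Icc (l x) (u x) ∧
      ∀ i, x ∈ Icc ((H i).c - ε) ((H i).d + ε) →
        y ∉ Ioo (extendConst (H i).c (H i).d (H i).g x)
          (extendConst (H i).c (H i).d (H i).h x)} := by
  rw [hF.value x hx]
  ext y
  simp only [mem_sdiff, mem_ofPred_eq, not_exists]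
  refine and_congr_right fun _ => forall_congr' fun i => ?_
  constructor
  · intro h _ hy
    by_cases hxi : x ∈ Ioo (H i).c (H i).d
    · rw [extendConst_of_mem (Ioo_subset_Icc_self hxi),
        extendConst_of_mem (Ioo_subset_Icc_self hxi)] at hy
      exact h ⟨hxi, hy.1, hy.2⟩
    · have hcd := (hF.hole i).c_lt_d.le
      have : max (H i).c (min (H i).d x) = (H i).c ∨ max (H i).c (min (H i).d x) = (H i).d := by
        rcases le_or_gt x (H i).c with h1 | h1
        · left
          rw [min_eq_right (h1.trans hcd), max_eq_left h1]
        · right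
          rw [min_eq_left (not_lt.1 fun h2 => hxi ⟨h1, h2⟩), max_eq_right hcd]
      rw [extendConst_eq hcd, extendConst_eq hcd] at hy
      have hlt := hy.1.trans hy.2
      rcases this with e | e
      · rw [e, (hF.hole i).left_eq] at hlt
        exact lt_irrefl _ hlt
      · rw [e, (hF.hole i).right_eq] at hlt
        exact lt_irrefl _ hlt
  · rintro h ⟨h1, h2, h3⟩
    refine h ⟨by linarith [h1.1], by linarith [h1.2]⟩ ?_
    rw [extendConst_of_mem (Ioo_subset_Icc_self h1), extendConst_of_mem (Ioo_subset_Icc_self h1)]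
    exact ⟨h2, h3⟩

/-! ### The distance between the set-valued function and its approximation -/

/-- If all boundaries are known up to an error that is small compared with their distances, then
the approximate boundaries have the same order, and the bands between them are as close to the
exact ones as the boundaries are. -/
theorem HasC4Holes.approx_spec {a b : ℝ} {l u : ℝ → ℝ} {M : ℕ} {F : ℝ → Set ℝ}
    {H : Fin M → Hole} (hF : HasC4Holes a b F l u H) {ε γ δ x : ℝ} (hε : 0 < ε)
    (hx : x ∈ Icc a b) {N : ℕ} (hδ : 0 ≤ δ) (hγ : 0 < γ) (hδγ : 3 * δ ≤ γ)
    (hlu : l x + γ ≤ u x)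
    (hgap : ∀ i, x ∈ Icc ((H i).c - ε) ((H i).d + ε) →
        l x + γ ≤ extendConst (H i).c (H i).d (H i).g x ∧
        extendConst (H i).c (H i).d (H i).h x + γ ≤ u x ∧
        ∀ j, j ≠ i → x ∈ Icc ((H j).c - ε) ((H j).d + ε) →
          extendConst (H i).c (H i).d (H i).h x + γ ≤ extendConst (H j).c (H j).d (H j).g x ∨
          extendConst (H j).c (H j).d (H j).h x + γ ≤ extendConst (H i).c (H i).d (H i).g x)
    (hl : |gridSpline a b N l x - l x| ≤ δ) (hu : |gridSpline a b N u x - u x| ≤ δ)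
    (hgh : ∀ i, |(H i).approxBoundary a b N (H i).g x - extendConst (H i).c (H i).d (H i).g x| ≤ δ ∧
      |(H i).approxBoundary a b N (H i).h x - extendConst (H i).c (H i).d (H i).h x| ≤ δ) :
    (approx a b l u H ε N x).Nonempty ∧ IsCompact (approx a b l u H ε N x) ∧
      Metric.hausdorffDist (F x) (approx a b l u H ε N x) ≤ δ := by
  unfold approx
  have hpair := List.pairwise_insertionSort
    (fun i j => (H i).approxBoundary a b N (H i).g x ≤ (H j).approxBoundary a b N (H j).g x)
    ((List.finRange M).filter fun i => x ∈ Icc ((H i).c - ε) ((H i).d + ε))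
  have hperm := List.perm_insertionSort
    (fun i j => (H i).approxBoundary a b N (H i).g x ≤ (H j).approxBoundary a b N (H j).g x)
    ((List.finRange M).filter fun i => x ∈ Icc ((H i).c - ε) ((H i).d + ε))
  set L := ((List.finRange M).filter fun i => x ∈ Icc ((H i).c - ε) ((H i).d + ε)).insertionSort
    fun i j => (H i).approxBoundary a b N (H i).g x ≤ (H j).approxBoundary a b N (H j).g x
  have hmem : ∀ i, i ∈ L ↔ x ∈ Icc ((H i).c - ε) ((H i).d + ε) := fun i => by
    rw [hperm.mem_iff]; simp
  have hnodup : L.Nodup := hperm.nodup_iff.2 ((List.nodup_finRange M).filter _)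
  have hval := hF.value_eq hε hx
  have hle : ∀ i, extendConst (H i).c (H i).d (H i).g x ≤ extendConst (H i).c (H i).d (H i).h x :=
    fun i => (hF.hole i).extend_g_le_h x
  have hg : ∀ i, |(H i).approxBoundary a b N (H i).g x -
    extendConst (H i).c (H i).d (H i).g x| ≤ δ := fun i => (hgh i).1
  have hh : ∀ i, |(H i).approxBoundary a b N (H i).h x -
    extendConst (H i).c (H i).d (H i).h x| ≤ δ := fun i => (hgh i).2
  simp only [← hmem] at hval hgap
  clear_value L
  clear hgh hmem hperm
  generalize hG : (fun i => (H i).approxBoundary a b N (H i).g x) = G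
  generalize hK : (fun i => (H i).approxBoundary a b N (H i).h x) = K
  replace hg : ∀ i, |G i - extendConst (H i).c (H i).d (H i).g x| ≤ δ := hG ▸ hg
  replace hh : ∀ i, |K i - extendConst (H i).c (H i).d (H i).h x| ≤ δ := hK ▸ hh
  replace hpair : L.Pairwise fun i j => G i ≤ G j := hG ▸ hpair
  clear hG hK
  generalize hG' : (fun i => extendConst (H i).c (H i).d (H i).g x) = g at *
  generalize hK' : (fun i => extendConst (H i).c (H i).d (H i).h x) = h at *
  have eg : ∀ i, extendConst (H i).c (H i).d (H i).g x = g i := fun i => congrFun hG' i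
  have eh : ∀ i, extendConst (H i).c (H i).d (H i).h x = h i := fun i => congrFun hK' i
  simp only [eg, eh] at hgap hval hle hg hh
  generalize gridSpline a b N l x = l' at *
  generalize gridSpline a b N u x = u' at *
  have hg' := fun i => abs_le.1 (hg i)
  have hh' := fun i => abs_le.1 (hh i)
  have hl' := abs_le.1 hl
  have hu' := abs_le.1 hu
  have hord : L.Pairwise fun i j => h i + γ ≤ g j := by
    refine (List.pairwise_and_iff.2 ⟨hpair, hnodup⟩).imp_of_mem fun {i j} hi hj hij => ?_
    -- the approximate order cannot contradict the exact one, since errors are small against `γ`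
    rcases (hgap i hi).2.2 j hij.2.symm hj with h1 | h1
    · exact h1
    · linarith [hij.1, (hg' i).1, (hg' j).2, hle j]
  have hord' : L.Pairwise fun i j => K i ≤ G j := hord.imp fun {i j} hij => by
    linarith [(hg' j).1, (hh' i).2]
  have hbot : ∀ i ∈ L, l' ≤ G i := fun i hi => by
    linarith [(hgap i hi).1, (hg' i).1, hl'.2]
  have htop : ∀ i ∈ L, K i ≤ u' := fun i hi => by
    linarith [(hgap i hi).2.1, (hh' i).2, hu'.1]
  have hlu' : l' ≤ u' := by linarith [hl'.2, hu'.1]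
  have hbot₀ : ∀ i ∈ L, l x ≤ g i := fun i hi => by linarith [(hgap i hi).1]
  have htop₀ : ∀ i ∈ L, h i ≤ u x := fun i hi => by linarith [(hgap i hi).2.1]
  have hord₀ : L.Pairwise fun i j => h i ≤ g j := hord.imp fun {i j} hij => by linarith
  have hlu₀ : l x ≤ u x := by linarith
  refine ⟨bands_nonempty hlu' hbot, isCompact_bands, ?_⟩
  have hFx : F x = bands g h (u x) (l x) L := by
    rw [hval, bands_eq hlu₀ hbot₀ htop₀ (fun i _ => hle i) hord₀]
  rw [hFx]
  refine Metric.hausdorffDist_le_of_mem_dist hδ (fun y hy => ?_) (fun y hy => ?_)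
  · exact exists_mem_bands_abs_sub_le hlu' hbot htop hord' (by rwa [abs_sub_comm])
      (by rwa [abs_sub_comm]) (fun i _ => by rw [abs_sub_comm]; exact hg i)
      (fun i _ => by rw [abs_sub_comm]; exact hh i) hy
  · exact exists_mem_bands_abs_sub_le hlu₀ hbot₀ htop₀ hord₀ hl hu (fun i _ => hg i)
      (fun i _ => hh i) hy

end SetValued

theorem mainTheorem2 {a b : ℝ} (hab : a < b) {M : ℕ} (F : ℝ → Set ℝ) (l u : ℝ → ℝ)
    (H : Fin M → SetValued.Hole) (hF : SetValued.HasC4Holes a b F l u H)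
    (hT : ∀ i, (H i).IsTransversal) :
    (∃ ε : ℝ, SetValued.IsAdmissible a b l u H ε) ∧
    ∃ C : ℝ, 0 < C ∧ ∀ ε : ℝ, SetValued.IsAdmissible a b l u H ε →
      ∃ Δ₀ : ℝ, 0 < Δ₀ ∧ ∀ N : ℕ, 0 < N → SetValued.mesh a b N < Δ₀ →
        ∀ x ∈ Set.Icc a b,
          (SetValued.approx a b l u H ε N x).Nonempty ∧
          IsCompact (SetValued.approx a b l u H ε N x) ∧
          Metric.hausdorffDist (F x) (SetValued.approx a b l u H ε N x) ≤
            C * SetValued.mesh a b N ^ 4 := by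
  refine ⟨hF.exists_isAdmissible hab, ?_⟩
  obtain ⟨Cl, Δl, hCl, hΔl, hl⟩ := SetValued.exists_abs_gridSpline_sub_le hab hF.l_smooth
  obtain ⟨Cu, Δu, hCu, hΔu, hu⟩ := SetValued.exists_abs_gridSpline_sub_le hab hF.u_smooth
  choose CH ΔH hCH hΔH hH using fun i =>
    SetValued.Hole.exists_abs_approxBoundary_sub_le hab (hF.hole i) (hT i)
  obtain ⟨Δ₁, hΔ₁, hΔ₁H⟩ := SetValued.exists_pos_forall_le hΔH
  have hsum : ∀ i, CH i ≤ ∑ i, CH i := fun i =>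
    Finset.single_le_sum (fun j _ => hCH j) (Finset.mem_univ i)
  have hsum₀ : 0 ≤ ∑ i, CH i := Finset.sum_nonneg fun i _ => hCH i
  set C := Cl + Cu + ∑ i, CH i + 1
  have hC : 0 < C := by positivity
  refine ⟨C, hC, fun ε hε => ?_⟩
  obtain ⟨γ, hγ, hgap⟩ := hF.exists_gap hε
  refine ⟨min (min Δl Δu) (min Δ₁ (min 1 (γ / (3 * C)))), by positivity,
    fun N hN hΔ x hx => ?_⟩
  have hm := SetValued.mesh_pos hab hN
  simp only [lt_min_iff] at hΔ
  obtain ⟨⟨h1, h2⟩, h3, h4, h5⟩ := hΔ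
  have hm4 : 0 ≤ SetValued.mesh a b N ^ 4 := by positivity
  have hle : ∀ {c : ℝ}, c ≤ C → c * SetValued.mesh a b N ^ 4 ≤ C * SetValued.mesh a b N ^ 4 :=
    fun h => mul_le_mul_of_nonneg_right h hm4
  refine hF.approx_spec hε.1 hx (by positivity) hγ ?_ (hgap x hx).1 (hgap x hx).2
    ((hl N hN h1 x hx).trans (hle (by linarith))) ((hu N hN h2 x hx).trans (hle (by linarith)))
    (fun i => ?_)
  · have h6 : SetValued.mesh a b N ^ 4 ≤ SetValued.mesh a b N :=
      pow_le_of_le_one hm.le h4.le (by norm_num)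
    rw [lt_div_iff₀ (by positivity)] at h5
    have := mul_le_mul_of_nonneg_left h6 hC.le
    linarith
  · obtain ⟨k1, k2⟩ := hH i N hN (h3.trans_le (hΔ₁H i)) x
    have hCi : CH i ≤ C := by linarith [hsum i]
    exact ⟨k1.trans (hle hCi), k2.trans (hle hCi)⟩
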